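/- Let $G=\mathrm{SL}_2(\mathbb{F}_3)$ be the binary tetrahedral group (of order $24$), and let $K$ be a field whose characteristic does not divide $|G|$ and which contains an element of multiplicative order $8$. Then $\beta_{\mathrm{sep}}^K(G)=12$. Here, for a finite dimensional $KG$-module $V$, let $K[V]$ be the polynomial ring in the coordinates of $V$ with the induced $G$-action $(g\cdot f)(v)=f(g^{-1}v)$, and let $K[V]^G$ be the algebra of $G$-invariant polynomials. A set $S\subseteq K[V]^G$ is called separating if for all $v,w\in V$ with $G\cdot v\neq G\cdot w$ there is an $f\in S$ with $f(v)\neq f(w)$. The number $\beta_{\mathrm{sep}}(G,V)$ is the minimal positive integer $d$ such that the elements of degree at most $d$ in $K[V]^G$ form a separating set, and $\beta_{\mathrm{sep}}^K(G)$ is the supremum of $\beta_{\mathrm{sep}}(G,V)$ over all finite dimensional $KG$-modules $V$. -/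

import Mathlib

namespace SepNoether

open Matrix

variable {K G : Type*} [Field K] [Group G] {n : ℕ}

/-- The action of `g : G` on the polynomial ring `K[V] = K[x_1, …, x_n]` of the `K G`-module
`V = K ^ n` (column vectors) given by `ψ : G → GL_n(K)`: the `K`-algebra automorphism with
`g · x_j = ∑ i, ψ(g⁻¹)_{j i} x_i`, so that `(g · f)(v) = f(g⁻¹ · v)`. -/
noncomputable def polyAction (ψ : G →* GL (Fin n) K) (g : G) :
    MvPolynomial (Fin n) K →ₐ[K] MvPolynomial (Fin n) K :=
  MvPolynomial.aeval fun j : Fin n =>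
    ∑ i : Fin n, MvPolynomial.C ((ψ g⁻¹ : Matrix (Fin n) (Fin n) K) j i) * MvPolynomial.X i

/-- The algebra `K[V]^G` of invariant polynomials. -/
noncomputable def invariants (ψ : G →* GL (Fin n) K) : Subalgebra K (MvPolynomial (Fin n) K) :=
  ⨅ g : G, AlgHom.equalizer (polyAction ψ g) (AlgHom.id K (MvPolynomial (Fin n) K))

/-- The orbit `G · v` of a point `v` of `V = K ^ n`. -/
def orbit (ψ : G →* GL (Fin n) K) (v : Fin n → K) : Set (Fin n → K) :=
  Set.range fun g : G => (ψ g : Matrix (Fin n) (Fin n) K) *ᵥ v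

/-- `S` is a separating set of `G`-invariants: a set of invariant polynomials such that any two
points with different orbits take different values under some member of `S`. -/
def IsSeparatingSet (ψ : G →* GL (Fin n) K) (S : Set (MvPolynomial (Fin n) K)) : Prop :=
  S ⊆ invariants ψ ∧
    ∀ v w : Fin n → K, orbit ψ v ≠ orbit ψ w →
      ∃ f ∈ S, MvPolynomial.eval v f ≠ MvPolynomial.eval w f

/-- `β_sep(G, V)`: the minimal positive integer `d` such that the invariants of degree at most `d`
form a separating set (`⊤` if there were no such `d`). -/
noncomputable def betaSepModule (ψ : G →* GL (Fin n) K) : ℕ∞ :=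
  ⨅ (d : ℕ) (_ : 0 < d ∧ IsSeparatingSet ψ {f | f ∈ invariants ψ ∧ f.totalDegree ≤ d}), (d : ℕ∞)

variable (K G) in
/-- `β_sep^K(G)`: the supremum of `β_sep(G, V)` over all finite dimensional `K G`-modules `V`;
up to isomorphism these are the spaces `K ^ n` with a homomorphism `G → GL_n(K)`. -/
noncomputable def betaSep : ℕ∞ :=
  ⨆ (n : ℕ) (ψ : G →* GL (Fin n) K), betaSepModule ψ

end SepNoether

/-! Lower bound. For an invariant `f`, `24 * f v` is the sum of `f` over the translates of `v`. On
the module of Hurwitz units this expresses the values of `f` on the line through (1, 0) by the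
moments of the orbit of (1, 0). Below degree 12 these moments vanish except in degrees 0 and 8.
Since ξ^8 = 1, no invariant of degree below 12 distinguishes (1, 0) from (ξ, 0), while ξ^4 = -1
keeps their orbits apart (`twelve_le_betaSepModule`).

Upper bound. Over the algebraic closure, let all polynomials of degree at most 12 have equal orbit
sums at v and w (`SameMoments`). If -1 fixes both points, a product of twelve affine linear forms,
one for each element of G/{±1}, puts them in one orbit. If -1 moves v, say, some equivariant map π
to one of the three faithful two-dimensional modules has π v ≠ 0. There two quartic semi-invariants
and a sextic invariant yield enough invariants of degree at most 12 to separate orbits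
(`exists_twist_mulVec_eq`), so after translation π v = π w.

It remains to match v and w by the stabilizer S of π v, which has order at most 3. After a further
translation there is a polynomial D of degree at most 12 - |S| equal to 1 at π v and to 0 on the
rest of its orbit (`exists_cutOut`). Multiplied by |S| affine linear forms, D ∘ π still has degree
at most 12, and its orbit sum detects whether w lies in S v (`exists_mulVec_eq_of_cutOut`). -/

/-- The binary tetrahedral group. -/
abbrev SL23 : Type := Matrix.SpecialLinearGroup (Fin 2) (ZMod 3)

/-! ### Elements of SL_2(𝔽_3) as Hurwitz units -/

namespace SL23

open Matrix

/-- The coordinates of `g` with respect to the quaternion basis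
`1`, `[[0, 1], [-1, 0]]`, `[[1, 1], [1, -1]]`, `[[1, -1], [-1, -1]]` of `M_2(𝔽_3)`. -/
def quat0 (g : SL23) : ZMod 3 := -(g.1 0 0 + g.1 1 1)
def quat1 (g : SL23) : ZMod 3 := g.1 1 0 - g.1 0 1
def quat2 (g : SL23) : ZMod 3 := g.1 0 0 + g.1 0 1 + g.1 1 0 - g.1 1 1
def quat3 (g : SL23) : ZMod 3 := g.1 0 0 - g.1 0 1 - g.1 1 0 - g.1 1 1

/-- The quotient homomorphism of `SL_2(𝔽_3)` onto `ℤ/3`, with kernel the quaternion group. -/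
def cls (g : SL23) : ZMod 3 := quat0 g * quat1 g * quat2 g * quat3 g

/-- The representative of least absolute value. -/
def centredLift (x : ZMod 3) : ℤ := if x = 0 then 0 else if x = 1 then 1 else -1

/-- The factor that turns the lift of a quaternion of norm one into twice a Hurwitz unit. -/
def liftScale (g : SL23) : ℤ := if cls g = 0 then 2 else -1

/-- The coordinates of twice the Hurwitz unit whose reduction modulo `3` is `g`. -/
def hur0 (g : SL23) : ℤ := liftScale g * centredLift (quat0 g)
def hur1 (g : SL23) : ℤ := liftScale g * centredLift (quat1 g)
def hur2 (g : SL23) : ℤ := liftScale g * centredLift (quat2 g)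
def hur3 (g : SL23) : ℤ := liftScale g * centredLift (quat3 g)

theorem cls_mul : ∀ g h : SL23, cls (g * h) = cls g + cls h := by decide +kernel

theorem cls_one : cls 1 = 0 := by decide +kernel

/-- Hurwitz units reduce bijectively onto the quaternions of norm one over 𝔽_3, and 1/2 reduces to
-1, whence the factor -1 in `liftScale`. The lift is therefore multiplicative; the 2 on the left
appears because the coordinates are those of twice the unit. -/
theorem hur0_mul : ∀ g h : SL23, 2 * hur0 (g * h) =
    hur0 g * hur0 h - hur1 g * hur1 h - hur2 g * hur2 h - hur3 g * hur3 h := by decide +kernel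

theorem hur1_mul : ∀ g h : SL23, 2 * hur1 (g * h) =
    hur0 g * hur1 h + hur1 g * hur0 h + hur2 g * hur3 h - hur3 g * hur2 h := by decide +kernel

theorem hur2_mul : ∀ g h : SL23, 2 * hur2 (g * h) =
    hur0 g * hur2 h - hur1 g * hur3 h + hur2 g * hur0 h + hur3 g * hur1 h := by decide +kernel

theorem hur3_mul : ∀ g h : SL23, 2 * hur3 (g * h) =
    hur0 g * hur3 h + hur1 g * hur2 h - hur2 g * hur1 h + hur3 g * hur0 h := by decide +kernel

theorem hur_one : hur0 1 = 2 ∧ hur1 1 = 0 ∧ hur2 1 = 0 ∧ hur3 1 = 0 := by decide +kernel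

theorem hur_of_cls_eq_zero : ∀ g : SL23, cls g = 0 →
    (hur1 g = 0 ∧ hur2 g = 0 ∧ hur3 g = 0 ∧ (hur0 g = 2 ∧ g = 1 ∨ hur0 g = -2 ∧ g = -1)) ∨
    (hur0 g = 0 ∧ hur2 g = 0 ∧ hur3 g = 0 ∧ (hur1 g = 2 ∨ hur1 g = -2)) ∨
    (hur0 g = 0 ∧ hur1 g = 0 ∧ hur3 g = 0 ∧ (hur2 g = 2 ∨ hur2 g = -2)) ∨
    (hur0 g = 0 ∧ hur1 g = 0 ∧ hur2 g = 0 ∧ (hur3 g = 2 ∨ hur3 g = -2)) := by decide +kernel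

theorem hur_of_cls_ne_zero : ∀ g : SL23, cls g ≠ 0 →
    (hur0 g = 1 ∨ hur0 g = -1) ∧ (hur1 g = 1 ∨ hur1 g = -1) ∧
    (hur2 g = 1 ∨ hur2 g = -1) ∧ (hur3 g = 1 ∨ hur3 g = -1) := by decide +kernel

/-- The element of `SL_2(𝔽_3)` corresponding to the quaternion `i`. -/
def qi : SL23 := ⟨!![0, 1; -1, 0], by decide +kernel⟩
/-- The element of `SL_2(𝔽_3)` corresponding to the quaternion `j`. -/
def qj : SL23 := ⟨!![1, 1; 1, -1], by decide +kernel⟩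
/-- The element of `SL_2(𝔽_3)` corresponding to the Hurwitz unit `(1 + i + j + k) / 2`. -/
def qu : SL23 := ⟨!![0, -1; 1, 1], by decide +kernel⟩

theorem hur_qi : hur0 qi = 0 ∧ hur1 qi = 2 ∧ hur2 qi = 0 ∧ hur3 qi = 0 := by decide +kernel
theorem hur_qj : hur0 qj = 0 ∧ hur1 qj = 0 ∧ hur2 qj = 2 ∧ hur3 qj = 0 := by decide +kernel
theorem hur_qu : hur0 qu = 1 ∧ hur1 qu = 1 ∧ hur2 qu = 1 ∧ hur3 qu = 1 := by decide +kernel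
theorem hur_neg_one : hur0 (-1) = -2 ∧ hur1 (-1) = 0 ∧ hur2 (-1) = 0 ∧ hur3 (-1) = 0 := by
  decide +kernel
theorem cls_qi : cls qi = 0 := by decide +kernel
theorem cls_qj : cls qj = 0 := by decide +kernel
theorem cls_qu : cls qu = 1 := by decide +kernel
theorem cls_neg_one : cls (-1) = 0 := by decide +kernel

theorem card_eq : Fintype.card SL23 = 24 := by decide +kernel

theorem exists_eq_prod : ∀ g : SL23, ∃ (a : Fin 4) (b : Fin 2) (c : Fin 3),
    g = qi ^ (a : ℕ) * qj ^ (b : ℕ) * qu ^ (c : ℕ) := by decide +kernel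

theorem induction_on {p : SL23 → Prop} (g : SL23) (one : p 1) (i : p qi) (j : p qj) (u : p qu)
    (mul : ∀ g h, p g → p h → p (g * h)) : p g := by
  have pow : ∀ g, p g → ∀ m : ℕ, p (g ^ m) := by
    intro g hg m
    induction m with
    | zero => simpa using one
    | succ m ih => rw [pow_succ]; exact mul _ _ ih hg
  obtain ⟨a, b, c, rfl⟩ := exists_eq_prod g
  exact mul _ _ (mul _ _ (pow _ i _) (pow _ j _)) (pow _ u _)

/-! ### The two-dimensional representation by Hurwitz units -/

section Rep

variable {F : Type*} [Field F]

/-- The two-dimensional representation of the binary tetrahedral group by Hurwitz units, over a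
field with a square root `ι` of `-1`. -/
def rho (ι : F) (hι : ι * ι = -1) (h2 : (2 : F) ≠ 0) : SL23 →* Matrix (Fin 2) (Fin 2) F where
  toFun g := !![(hur0 g + hur1 g * ι) / 2, (hur2 g + hur3 g * ι) / 2;
    (-hur2 g + hur3 g * ι) / 2, (hur0 g - hur1 g * ι) / 2]
  map_one' := by
    obtain ⟨h0, h1, h2', h3⟩ := hur_one
    rw [h0, h1, h2', h3]
    ext i j
    fin_cases i <;> fin_cases j <;> simp [h2]
  map_mul' g h := by
    have e0 := congrArg (Int.cast : ℤ → F) (hur0_mul g h)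
    have e1 := congrArg (Int.cast : ℤ → F) (hur1_mul g h)
    have e2 := congrArg (Int.cast : ℤ → F) (hur2_mul g h)
    have e3 := congrArg (Int.cast : ℤ → F) (hur3_mul g h)
    push_cast at e0 e1 e2 e3
    have h4 : (4 : F) ≠ 0 := by
      have : (4 : F) = 2 * 2 := by norm_num
      rw [this]; exact mul_ne_zero h2 h2
    ext i j
    fin_cases i <;> fin_cases j <;>
      simp only [Matrix.mul_apply, Fin.sum_univ_two, Fin.zero_eta, Fin.mk_one, Matrix.of_apply,
        Matrix.cons_val', Matrix.cons_val_zero, Matrix.cons_val_one, Matrix.cons_val_fin_one] <;>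
      apply mul_left_cancel₀ h4 <;> field_simp
    · linear_combination e0 + ι * e1 + (hur3 g * hur3 h + hur1 g * hur1 h : F) * (-hι)
    · linear_combination e2 + ι * e3 + (-hur1 g * hur3 h + hur3 g * hur1 h : F) * hι
    · linear_combination -e2 + ι * e3 + (-hur3 g * hur1 h + hur1 g * hur3 h : F) * hι
    · linear_combination e0 - ι * e1 + (hur3 g * hur3 h + hur1 g * hur1 h : F) * (-hι)

variable (ι : F) (hι : ι * ι = -1) (h2 : (2 : F) ≠ 0)

theorem rho_mulVec_zero (g : SL23) (a : Fin 2 → F) : (rho ι hι h2 g *ᵥ a) 0 =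
    (hur0 g + hur1 g * ι) / 2 * a 0 + (hur2 g + hur3 g * ι) / 2 * a 1 := by
  simp [rho, Matrix.mulVec, dotProduct, Fin.sum_univ_two]

theorem rho_mulVec_one (g : SL23) (a : Fin 2 → F) : (rho ι hι h2 g *ᵥ a) 1 =
    (-hur2 g + hur3 g * ι) / 2 * a 0 + (hur0 g - hur1 g * ι) / 2 * a 1 := by
  simp [rho, Matrix.mulVec, dotProduct, Fin.sum_univ_two]

theorem rho_qi (a : Fin 2 → F) : rho ι hι h2 qi *ᵥ a = ![ι * a 0, -ι * a 1] := by
  obtain ⟨h0, h1, h2', h3⟩ := hur_qi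
  ext i
  fin_cases i
  · simp [rho_mulVec_zero, h0, h1, h2', h3, h2]
  · simp [rho_mulVec_one, h0, h1, h2', h3, h2, neg_div]

theorem rho_qj (a : Fin 2 → F) : rho ι hι h2 qj *ᵥ a = ![a 1, -a 0] := by
  obtain ⟨h0, h1, h2', h3⟩ := hur_qj
  ext i
  fin_cases i
  · simp [rho_mulVec_zero, h0, h1, h2', h3, h2]
  · simp [rho_mulVec_one, h0, h1, h2', h3, h2]

theorem rho_neg_one (a : Fin 2 → F) : rho ι hι h2 (-1) *ᵥ a = -a := by
  obtain ⟨h0, h1, h2', h3⟩ := hur_neg_one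
  ext i
  fin_cases i
  · simp [rho_mulVec_zero, h0, h1, h2', h3, h2]
  · simp [rho_mulVec_one, h0, h1, h2', h3, h2]

theorem rho_qu (a : Fin 2 → F) : rho ι hι h2 qu *ᵥ a =
    ![(1 + ι) / 2 * (a 0 + a 1), (ι - 1) / 2 * (a 0 - a 1)] := by
  obtain ⟨h0, h1, h2', h3⟩ := hur_qu
  ext i
  fin_cases i
  · simp [rho_mulVec_zero, h0, h1, h2', h3]; ring
  · simp [rho_mulVec_one, h0, h1, h2', h3]; ring

/-- The eight elements of the quaternion group act by signs and powers of `ι`. -/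
theorem rho_of_cls_eq_zero {g : SL23} (hg : cls g = 0) (a : Fin 2 → F) :
    (g = 1 ∨ g = -1) ∨ ∃ s : F, s * s = 1 ∧
      (rho ι hι h2 g *ᵥ a = ![s * ι * a 0, -(s * ι) * a 1] ∨
       rho ι hι h2 g *ᵥ a = ![s * a 1, -s * a 0] ∨
       rho ι hι h2 g *ᵥ a = ![s * ι * a 1, s * ι * a 0]) := by
  rcases hur_of_cls_eq_zero g hg with ⟨_, _, _, h⟩ | ⟨e1, e2, e3, h⟩ | ⟨e1, e2, e3, h⟩ |
    ⟨e1, e2, e3, h⟩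
  · left; tauto
  all_goals
    right
    rcases h with h | h
  · refine ⟨1, by ring, Or.inl ?_⟩
    ext i; fin_cases i <;> simp [rho_mulVec_zero, rho_mulVec_one, e1, e2, e3, h, h2, neg_div]
  · refine ⟨-1, by ring, Or.inl ?_⟩
    ext i; fin_cases i <;> simp [rho_mulVec_zero, rho_mulVec_one, e1, e2, e3, h, h2, neg_div]
  · refine ⟨1, by ring, Or.inr (Or.inl ?_)⟩
    ext i; fin_cases i <;> simp [rho_mulVec_zero, rho_mulVec_one, e1, e2, e3, h, h2]
  · refine ⟨-1, by ring, Or.inr (Or.inl ?_)⟩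
    ext i; fin_cases i <;> simp [rho_mulVec_zero, rho_mulVec_one, e1, e2, e3, h, h2]
  · refine ⟨1, by ring, Or.inr (Or.inr ?_)⟩
    ext i; fin_cases i <;> simp [rho_mulVec_zero, rho_mulVec_one, e1, e2, e3, h, h2]
  · refine ⟨-1, by ring, Or.inr (Or.inr ?_)⟩
    ext i; fin_cases i <;> simp [rho_mulVec_zero, rho_mulVec_one, e1, e2, e3, h, h2, neg_div]

/-- The images of a point on the first coordinate axis. -/
theorem rho_axis (g : SL23) (α : F) (hα : α ≠ 0) :
    (cls g = 0 ∧ ∃ t : F, t ^ 4 = 1 ∧ rho ι hι h2 g *ᵥ ![α, 0] = ![t * α, 0]) ∨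
    (rho ι hι h2 g *ᵥ ![α, 0]) 1 ≠ 0 ∧ ((rho ι hι h2 g *ᵥ ![α, 0]) 0 = 0 ∨
      (rho ι hι h2 g *ᵥ ![α, 0]) 0 ^ 4 = (rho ι hι h2 g *ᵥ ![α, 0]) 1 ^ 4) := by
  have hι0 : ι ≠ 0 := by rintro rfl; simp at hι
  have hι4 : ι ^ 4 = 1 := by linear_combination (ι * ι - 1) * hι
  by_cases hg : cls g = 0
  · rcases rho_of_cls_eq_zero ι hι h2 hg ![α, 0] with (rfl | rfl) | ⟨s, hs, h | h | h⟩
    · exact Or.inl ⟨hg, 1, by ring, by simp⟩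
    · exact Or.inl ⟨hg, -1, by ring, by rw [rho_neg_one]; ext i; fin_cases i <;> simp⟩
    · exact Or.inl ⟨hg, s * ι, by
        rw [mul_pow, hι4]; linear_combination (s * s + 1) * hs, by rw [h]; simp⟩
    all_goals
      have hs0 : s ≠ 0 := by rintro rfl; simp at hs
      right
      rw [h]
      simp [hs0, hα, hι0]
  · right
    obtain ⟨a0, a1, a2, a3⟩ := hur_of_cls_ne_zero g hg
    -- Outside the quaternion group both coordinates of the image are (±1 ± ι)/2 times α. As (±1 ±
    -- ι)^2 = ±2ι, their fourth powers agree and are nonzero.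
    have key : ∀ x y : F, x * x = 1 → y * y = 1 → ((x + y * ι) / 2 * α) ^ 4 = - (α ^ 4) / 4 := by
      intro x y hx hy
      have h4 : (4 : F) ≠ 0 := by
        have : (4 : F) = 2 * 2 := by norm_num
        rw [this]; exact mul_ne_zero h2 h2
      have h16 : (16 : F) ≠ 0 := by
        have : (16 : F) = 4 * 4 := by norm_num
        rw [this]; exact mul_ne_zero h4 h4
      have e : (x + y * ι) ^ 2 = 2 * x * y * ι := by linear_combination hx + ι * ι * hy + hι
      have : (x + y * ι) ^ 4 = -4 := by
        calc (x + y * ι) ^ 4 = ((x + y * ι) ^ 2) ^ 2 := by ring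
          _ = 4 * (x * x) * (y * y) * (ι * ι) := by rw [e]; ring
          _ = -4 := by rw [hx, hy, hι]; ring
      rw [mul_pow, div_pow, this]
      field_simp
      ring
    have sq : ∀ n : ℤ, n = 1 ∨ n = -1 → (n : F) * n = 1 := by
      rintro n (rfl | rfl) <;> simp
    have e0 : (rho ι hι h2 g *ᵥ ![α, 0]) 0 ^ 4 = - (α ^ 4) / 4 := by
      rw [rho_mulVec_zero]
      simpa using key _ _ (sq _ a0) (sq _ a1)
    have e1 : (rho ι hι h2 g *ᵥ ![α, 0]) 1 ^ 4 = - (α ^ 4) / 4 := by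
      rw [rho_mulVec_one]
      simpa using key (-hur2 g) _ (by simpa using sq _ a2) (sq _ a3)
    refine ⟨fun h => ?_, Or.inr (e0.trans e1.symm)⟩
    rw [h] at e1
    have h4 : (4 : F) ≠ 0 := by
      have : (4 : F) = 2 * 2 := by norm_num
      rw [this]; exact mul_ne_zero h2 h2
    have : α ^ 4 = 0 := by
      field_simp at e1
      simpa using e1.symm
    exact hα (pow_eq_zero_iff (by norm_num) |>.1 this)

end Rep

end SL23

/-! ### The action on polynomials: evaluation and degree -/

namespace SepNoether

open Matrix

section General

variable {K G : Type*} [Field K] [Group G] {n : ℕ}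

theorem eval_polyAction (ψ : G →* GL (Fin n) K) (g : G) (f : MvPolynomial (Fin n) K)
    (v : Fin n → K) : MvPolynomial.eval v (polyAction ψ g f) =
      MvPolynomial.eval ((ψ g⁻¹ : Matrix (Fin n) (Fin n) K) *ᵥ v) f := by
  induction f using MvPolynomial.induction_on with
  | C a => simp [polyAction]
  | add p q hp hq => simp [hp, hq]
  | mul_X p i hp =>
    rw [map_mul, map_mul, map_mul, hp]
    simp [polyAction, Matrix.mulVec, dotProduct]

theorem mem_invariants_iff (ψ : G →* GL (Fin n) K) (f : MvPolynomial (Fin n) K) :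
    f ∈ invariants ψ ↔ ∀ g, polyAction ψ g f = f := by
  simp [invariants, Algebra.mem_iInf, AlgHom.mem_equalizer]

theorem eval_mulVec_of_mem_invariants {ψ : G →* GL (Fin n) K} {f : MvPolynomial (Fin n) K}
    (hf : f ∈ invariants ψ) (g : G) (v : Fin n → K) :
    MvPolynomial.eval ((ψ g : Matrix (Fin n) (Fin n) K) *ᵥ v) f = MvPolynomial.eval v f := by
  have := eval_polyAction ψ g⁻¹ f v
  rw [(mem_invariants_iff ψ f).1 hf, inv_inv] at this
  exact this.symm

theorem polyAction_polyAction (ψ : G →* GL (Fin n) K) (g h : G) (f : MvPolynomial (Fin n) K) :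
    polyAction ψ g (polyAction ψ h f) = polyAction ψ (g * h) f := by
  rw [← AlgHom.comp_apply]
  congr 1
  apply MvPolynomial.algHom_ext
  intro j
  simp only [AlgHom.comp_apply, polyAction, MvPolynomial.aeval_X, map_sum, map_mul,
    MvPolynomial.algHom_C, MvPolynomial.algebraMap_eq, Finset.mul_sum, _root_.mul_inv_rev, Units.val_mul,
    Matrix.mul_apply, Finset.sum_mul]
  rw [Finset.sum_comm]
  simp only [mul_assoc]

theorem totalDegree_aeval_le {m : ℕ} (q : Fin n → MvPolynomial (Fin m) K)
    (hq : ∀ j, (q j).totalDegree ≤ 1) (f : MvPolynomial (Fin n) K) :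
    (MvPolynomial.aeval q f).totalDegree ≤ f.totalDegree := by
  rw [MvPolynomial.aeval_def, MvPolynomial.eval₂_eq]
  refine MvPolynomial.totalDegree_finsetSum_le fun s hs => ?_
  refine (MvPolynomial.totalDegree_mul _ _).trans ?_
  rw [MvPolynomial.algebraMap_eq, MvPolynomial.totalDegree_C, zero_add]
  refine (MvPolynomial.totalDegree_finsetProd _ _).trans ?_
  refine le_trans (Finset.sum_le_sum fun i _ => ?_) (MvPolynomial.le_totalDegree hs)
  refine (MvPolynomial.totalDegree_pow _ _).trans ?_
  simpa using Nat.mul_le_mul_left (s i) (hq i)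

theorem totalDegree_polyAction_le (ψ : G →* GL (Fin n) K) (g : G) (f : MvPolynomial (Fin n) K) :
    (polyAction ψ g f).totalDegree ≤ f.totalDegree := by
  refine totalDegree_aeval_le _ (fun j => ?_) f
  refine MvPolynomial.totalDegree_finsetSum_le fun i _ => ?_
  refine (MvPolynomial.totalDegree_mul _ _).trans ?_
  simp

end General

end SepNoether

/-! ### Moments of the orbit of (1, 0) and the lower bound -/

namespace SL23

open Matrix

section Axis

variable {F : Type*} [Field F] (ι : F) (hι : ι * ι = -1) (h2 : (2 : F) ≠ 0)

/-- The sum of the values of the monomial `x ^ a * y ^ b` over the orbit of `(1, 0)`. -/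
noncomputable def orbitMoment (a b : ℕ) : F :=
  ∑ g : SL23, (rho ι hι h2 g *ᵥ ![1, 0]) 0 ^ a * (rho ι hι h2 g *ᵥ ![1, 0]) 1 ^ b

theorem orbitMoment_translate (h : SL23) (a b : ℕ) : orbitMoment ι hι h2 a b =
    ∑ g : SL23, (rho ι hι h2 h *ᵥ (rho ι hι h2 g *ᵥ ![1, 0])) 0 ^ a *
      (rho ι hι h2 h *ᵥ (rho ι hι h2 g *ᵥ ![1, 0])) 1 ^ b := by
  rw [orbitMoment, ← Equiv.sum_comp (Equiv.mulLeft h)]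
  simp only [Equiv.coe_mulLeft, map_mul, Matrix.mulVec_mulVec]

theorem orbitMoment_qi (a b : ℕ) :
    orbitMoment ι hι h2 a b = ι ^ a * (-ι) ^ b * orbitMoment ι hι h2 a b := by
  conv_lhs => rw [orbitMoment_translate ι hι h2 qi]
  rw [orbitMoment, Finset.mul_sum]
  refine Finset.sum_congr rfl fun g _ => ?_
  rw [rho_qi]
  simp only [cons_val_zero, cons_val_one, mul_pow]
  ring

theorem orbitMoment_qj (a b : ℕ) :
    orbitMoment ι hι h2 a b = (-1) ^ b * orbitMoment ι hι h2 b a := by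
  conv_lhs => rw [orbitMoment_translate ι hι h2 qj]
  rw [orbitMoment, Finset.mul_sum]
  refine Finset.sum_congr rfl fun g _ => ?_
  rw [rho_qj]
  simp only [cons_val_zero, cons_val_one]
  rw [neg_pow]
  ring

/-- Right translation by the quaternion `i` multiplies the point by `ι`. -/
theorem orbitMoment_right (a b : ℕ) :
    orbitMoment ι hι h2 a b = ι ^ (a + b) * orbitMoment ι hι h2 a b := by
  conv_lhs => rw [orbitMoment, ← Equiv.sum_comp (Equiv.mulRight qi)]
  rw [orbitMoment, Finset.mul_sum]
  refine Finset.sum_congr rfl fun g _ => ?_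
  have : rho ι hι h2 (g * qi) *ᵥ ![1, 0] = ι • (rho ι hι h2 g *ᵥ ![1, 0]) := by
    rw [map_mul, ← Matrix.mulVec_mulVec, rho_qi, ← Matrix.mulVec_smul]
    congr 1
    simp
  rw [Equiv.coe_mulRight, this]
  simp only [Pi.smul_apply, smul_eq_mul, mul_pow]
  ring

/-- There is no invariant quartic. Translation by `qi` kills the moments with odd exponents, `qj`
identifies the moments (4, 0) and (0, 4), and `qu` gives two linear relations between the moments
(4, 0) and (2, 2) that force both to vanish once 24 is invertible. -/
theorem orbitMoment_four (h24 : (24 : F) ≠ 0) (a b : ℕ) (hab : a + b = 4) : orbitMoment ι hι h2 a b = 0 := by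
  have hι4 : ι ^ 4 = 1 := by linear_combination (ι * ι - 1) * hι
  have h4 : (4 : F) ≠ 0 := by
    have : (4 : F) = 2 * 2 := by norm_num
    rw [this]; exact mul_ne_zero h2 h2
  have e31 : orbitMoment ι hι h2 3 1 = 0 := by
    have := orbitMoment_qi ι hι h2 3 1
    have h' : 2 * orbitMoment ι hι h2 3 1 = 0 := by
      linear_combination this - orbitMoment ι hι h2 3 1 * hι4
    exact (mul_eq_zero.1 h').resolve_left h2
  have e13 : orbitMoment ι hι h2 1 3 = 0 := by
    rw [orbitMoment_qj, e31, mul_zero]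
  have e04 : orbitMoment ι hι h2 0 4 = orbitMoment ι hι h2 4 0 := by
    rw [orbitMoment_qj]; norm_num
  have u40 : 4 * orbitMoment ι hι h2 4 0 = -(orbitMoment ι hι h2 4 0 +
      4 * orbitMoment ι hι h2 3 1 + 6 * orbitMoment ι hι h2 2 2 + 4 * orbitMoment ι hι h2 1 3 +
      orbitMoment ι hι h2 0 4) := by
    conv_lhs => rw [orbitMoment_translate ι hι h2 qu]
    simp only [orbitMoment, Finset.mul_sum, ← Finset.sum_add_distrib, ← Finset.sum_neg_distrib]
    refine Finset.sum_congr rfl fun g _ => ?_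
    rw [rho_qu]
    simp only [cons_val_zero, cons_val_one]
    generalize (rho ι hι h2 g *ᵥ ![1, 0]) 0 = x
    generalize (rho ι hι h2 g *ᵥ ![1, 0]) 1 = y
    have e : (1 + ι) ^ 4 = -4 := by linear_combination (ι ^ 2 + 4 * ι + 5) * hι
    rw [mul_pow, div_pow, e]
    field_simp
    ring
  have u22 : 4 * orbitMoment ι hι h2 2 2 = orbitMoment ι hι h2 4 0 -
      2 * orbitMoment ι hι h2 2 2 + orbitMoment ι hι h2 0 4 := by
    conv_lhs => rw [orbitMoment_translate ι hι h2 qu]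
    simp only [orbitMoment, Finset.mul_sum, ← Finset.sum_add_distrib, ← Finset.sum_sub_distrib]
    refine Finset.sum_congr rfl fun g _ => ?_
    rw [rho_qu]
    simp only [cons_val_zero, cons_val_one]
    generalize (rho ι hι h2 g *ᵥ ![1, 0]) 0 = x
    generalize (rho ι hι h2 g *ᵥ ![1, 0]) 1 = y
    have e : (1 + ι) ^ 2 * (ι - 1) ^ 2 = 4 := by linear_combination (ι ^ 2 - 3) * hι
    field_simp
    linear_combination 4 * (x + y) ^ 2 * (x - y) ^ 2 * e
  have e22 : orbitMoment ι hι h2 2 2 = 0 := by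
    rw [e31, e13, e04] at u40
    rw [e04] at u22
    have : (24 : F) * orbitMoment ι hι h2 2 2 = 0 := by
      linear_combination u40 + 3 * u22
    exact (mul_eq_zero.1 this).resolve_left h24
  have e40 : orbitMoment ι hι h2 4 0 = 0 := by
    rw [e04, e22] at u22
    have : (2 : F) * orbitMoment ι hι h2 4 0 = 0 := by linear_combination -u22
    exact (mul_eq_zero.1 this).resolve_left h2
  have : a = 0 ∧ b = 4 ∨ a = 1 ∧ b = 3 ∨ a = 2 ∧ b = 2 ∨ a = 3 ∧ b = 1 ∨ a = 4 ∧ b = 0 := by omega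
  rcases this with ⟨rfl, rfl⟩ | ⟨rfl, rfl⟩ | ⟨rfl, rfl⟩ | ⟨rfl, rfl⟩ | ⟨rfl, rfl⟩
  · rw [e04, e40]
  · exact e13
  · exact e22
  · exact e31
  · exact e40

/-- Right translation by `qi` scales the orbit points by ι, of order 4, so only degrees divisible by
4 can survive; degree 4 is treated above. -/
theorem orbitMoment_eq_zero (h24 : (24 : F) ≠ 0) (a b : ℕ) (hab : a + b < 12) (h0 : a + b ≠ 0) (h8 : a + b ≠ 8) :
    orbitMoment ι hι h2 a b = 0 := by
  by_cases h4 : a + b = 4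
  · exact orbitMoment_four ι hι h2 h24 a b h4
  have hι4 : ι ^ 4 = 1 := by linear_combination (ι * ι - 1) * hι
  have hι1 : ι ≠ 1 := by
    rintro rfl
    apply h2
    linear_combination hι
  have hr := orbitMoment_right ι hι h2 a b
  have hmod : ι ^ (a + b) = ι ^ ((a + b) % 4) := by
    conv_lhs => rw [← Nat.div_add_mod (a + b) 4, pow_add, pow_mul, hι4, one_pow, one_mul]
  have hne : ι ^ ((a + b) % 4) ≠ 1 := by
    have : (a + b) % 4 = 1 ∨ (a + b) % 4 = 2 ∨ (a + b) % 4 = 3 := by omega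
    rcases this with h | h | h <;> rw [h]
    · simpa using hι1
    · intro h'
      apply h2
      linear_combination hι - h'
    · intro h'
      have : ι = -1 := by linear_combination -h' + ι * hι
      rw [this] at hι
      apply h2
      linear_combination hι
  rw [hmod] at hr
  by_contra hne0
  exact hne (mul_right_cancel₀ hne0 (by rw [one_mul]; exact hr.symm))

end Axis

end SL23

namespace SepNoether

open Matrix SL23

/-- The two-dimensional module of the binary tetrahedral group given by the Hurwitz units. -/
noncomputable def hurwitzModule {K : Type*} [Field K] (ι : K) (hι : ι * ι = -1)
    (h2 : (2 : K) ≠ 0) : SL23 →* GL (Fin 2) K :=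
  (rho ι hι h2).toHomUnits

/-- The orbit of (1, 0) meets the first axis only in multiples by fourth roots of unity, and ξ is
not one. Moving from (1, 0) to (ξ, 0) multiplies a moment of degree m by ξ^m, which changes nothing
when m is 0 or 8. -/
theorem twelve_le_betaSepModule {K : Type*} [Field K] (ξ : K) (hξ : ξ ^ 4 = -1)
    (h24 : (24 : K) ≠ 0) (hι : ξ ^ 2 * ξ ^ 2 = -1) (h2 : (2 : K) ≠ 0) :
    12 ≤ betaSepModule (hurwitzModule (ξ ^ 2) hι h2) := by
  set ψ := hurwitzModule (ξ ^ 2) hι h2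
  have hψg : ∀ g v, (ψ g : Matrix (Fin 2) (Fin 2) K) *ᵥ v = rho (ξ ^ 2) hι h2 g *ᵥ v :=
    fun g v => rfl
  refine le_iInf₂ fun d hd => ?_
  by_contra hlt
  replace hlt : d < 12 := by exact_mod_cast not_le.1 hlt
  obtain ⟨-, -, hsep⟩ := hd
  have horb : orbit ψ ![1, 0] ≠ orbit ψ ![ξ, 0] := by
    intro h
    have hmem : ![ξ, 0] ∈ orbit ψ ![ξ, 0] := ⟨1, by simp⟩
    rw [← h] at hmem
    obtain ⟨g, hg⟩ := hmem
    simp only [hψg] at hg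
    rcases rho_axis (ξ ^ 2) hι h2 g 1 one_ne_zero with ⟨-, t, ht, h'⟩ | ⟨h', -⟩
    · rw [h'] at hg
      have : t = ξ := by simpa using congrFun hg 0
      rw [this, hξ] at ht
      apply h2
      linear_combination -ht
    · rw [hg] at h'
      simp at h'
  obtain ⟨f, ⟨hf, hfd⟩, hne⟩ := hsep _ _ horb
  apply hne
  have avg : ∀ v, (24 : K) * MvPolynomial.eval v f =
      ∑ s ∈ f.support, f.coeff s * ∑ g : SL23, ∏ i, (rho (ξ ^ 2) hι h2 g *ᵥ v) i ^ s i := by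
    intro v
    have e : ∑ g : SL23, MvPolynomial.eval (rho (ξ ^ 2) hι h2 g *ᵥ v) f =
        24 * MvPolynomial.eval v f := by
      simp only [← hψg, eval_mulVec_of_mem_invariants hf]
      rw [Finset.sum_const, Finset.card_univ, card_eq, nsmul_eq_mul]
      norm_num
    rw [← e]
    simp only [MvPolynomial.eval_eq']
    rw [Finset.sum_comm]
    simp only [Finset.mul_sum]
  apply mul_left_cancel₀ h24
  rw [avg, avg]
  refine Finset.sum_congr rfl fun s hs => ?_
  congr 1
  have hdeg : s 0 + s 1 < 12 := by
    have := MvPolynomial.le_totalDegree hs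
    rw [Finsupp.sum_fintype _ _ (fun _ => rfl), Fin.sum_univ_two] at this
    omega
  have hsmul : ![ξ, 0] = ξ • ![(1 : K), 0] := by simp
  have hw : ∑ g : SL23, ∏ i, (rho (ξ ^ 2) hι h2 g *ᵥ ![ξ, 0]) i ^ s i =
      ξ ^ (s 0 + s 1) * orbitMoment (ξ ^ 2) hι h2 (s 0) (s 1) := by
    rw [orbitMoment, Finset.mul_sum]
    refine Finset.sum_congr rfl fun g _ => ?_
    rw [hsmul, Matrix.mulVec_smul, Fin.prod_univ_two]
    simp only [Pi.smul_apply, smul_eq_mul, mul_pow]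
    ring
  have hv : ∑ g : SL23, ∏ i, (rho (ξ ^ 2) hι h2 g *ᵥ ![1, 0]) i ^ s i =
      orbitMoment (ξ ^ 2) hι h2 (s 0) (s 1) := by
    simp only [orbitMoment, Fin.prod_univ_two]
  rw [hw, hv]
  by_cases h0 : s 0 + s 1 = 0
  · rw [h0]; simp
  by_cases h8 : s 0 + s 1 = 8
  · rw [h8]
    linear_combination -(ξ ^ 4 - 1) * orbitMoment (ξ ^ 2) hι h2 (s 0) (s 1) * hξ
  · rw [orbitMoment_eq_zero _ _ _ h24 _ _ hdeg h0 h8, mul_zero]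

end SepNoether

/-! ### Polynomial functions of bounded degree -/

namespace SepNoether

open Matrix

/-- Functions on `F ^ n` given by polynomials of degree at most `d`. -/
def PolyLE {F : Type*} [Field F] {n : ℕ} (d : ℕ) (f : (Fin n → F) → F) : Prop :=
  ∃ p : MvPolynomial (Fin n) F, p.totalDegree ≤ d ∧ ∀ x, MvPolynomial.eval x p = f x

namespace PolyLE

variable {F : Type*} [Field F] {n : ℕ} {d e : ℕ} {f g : (Fin n → F) → F}

theorem mono (hf : PolyLE d f) (h : d ≤ e) : PolyLE e f := by
  obtain ⟨p, hp, hpf⟩ := hf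
  exact ⟨p, hp.trans h, hpf⟩

theorem const (c : F) : PolyLE (n := n) d fun _ => c :=
  ⟨MvPolynomial.C c, by simp, by simp⟩

theorem coord (i : Fin n) : PolyLE (F := F) 1 fun x => x i :=
  ⟨MvPolynomial.X i, by simp, by simp⟩

theorem add (hf : PolyLE d f) (hg : PolyLE d g) : PolyLE d fun x => f x + g x := by
  obtain ⟨p, hp, hpf⟩ := hf
  obtain ⟨q, hq, hqg⟩ := hg
  exact ⟨p + q, (MvPolynomial.totalDegree_add _ _).trans (max_le hp hq), by simp [hpf, hqg]⟩

theorem mul (hf : PolyLE d f) (hg : PolyLE e g) : PolyLE (d + e) fun x => f x * g x := by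
  obtain ⟨p, hp, hpf⟩ := hf
  obtain ⟨q, hq, hqg⟩ := hg
  exact ⟨p * q, (MvPolynomial.totalDegree_mul _ _).trans (add_le_add hp hq), by simp [hpf, hqg]⟩

theorem const_mul (c : F) (hf : PolyLE d f) : PolyLE d fun x => c * f x :=
  ((const (d := 0) c).mul hf).mono (by simp)

theorem div_const (c : F) (hf : PolyLE d f) : PolyLE d fun x => f x / c := by
  simpa only [div_eq_inv_mul] using hf.const_mul c⁻¹

theorem sub (hf : PolyLE d f) (hg : PolyLE d g) : PolyLE d fun x => f x - g x := by
  simpa only [neg_one_mul, sub_eq_add_neg] using hf.add (hg.const_mul (-1))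

theorem pow (hf : PolyLE d f) (m : ℕ) : PolyLE (m * d) fun x => f x ^ m := by
  obtain ⟨p, hp, hpf⟩ := hf
  exact ⟨p ^ m, (MvPolynomial.totalDegree_pow _ _).trans (Nat.mul_le_mul_left m hp),
    by simp [hpf]⟩

theorem sum {ι : Type*} (s : Finset ι) {f : ι → (Fin n → F) → F} (hf : ∀ i ∈ s, PolyLE d (f i)) :
    PolyLE d fun x => ∑ i ∈ s, f i x := by
  classical
  induction s using Finset.induction_on with
  | empty => simpa using const (n := n) (d := d) (0 : F)
  | insert a s ha ih =>
    simp only [Finset.sum_insert ha]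
    exact (hf a (by simp)).add (ih fun i hi => hf i (by simp [hi]))

theorem prod {ι : Type*} (s : Finset ι) {f : ι → (Fin n → F) → F} (hf : ∀ i ∈ s, PolyLE 1 (f i)) :
    PolyLE s.card fun x => ∏ i ∈ s, f i x := by
  classical
  induction s using Finset.induction_on with
  | empty => simpa using const (n := n) (d := 0) (1 : F)
  | insert a s ha ih =>
    simp only [Finset.prod_insert ha, Finset.card_insert_of_notMem ha]
    rw [add_comm]
    exact (hf a (by simp)).mul (ih fun i hi => hf i (by simp [hi]))

theorem linear (ℓ : (Fin n → F) →ₗ[F] F) : PolyLE 1 fun x => ℓ x := by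
  have : (fun x => ℓ x) = fun x => ∑ i, ℓ (Pi.single i 1) * x i := by
    funext x
    conv_lhs => rw [LinearMap.pi_apply_eq_sum_univ ℓ x]
    simp only [smul_eq_mul, mul_comm]
    refine Finset.sum_congr rfl fun i _ => ?_
    congr 2
    ext j
    simp [Pi.single_apply, eq_comm]
  rw [this]
  exact sum _ fun i _ => (coord i).const_mul _

theorem comp {m : ℕ} {q : (Fin m → F) → Fin n → F} (hf : PolyLE d f)
    (hq : ∀ i, PolyLE 1 fun x => q x i) : PolyLE d fun x => f (q x) := by
  obtain ⟨p, hp, hpf⟩ := hf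
  choose r hr hrq using hq
  refine ⟨MvPolynomial.aeval r p, (totalDegree_aeval_le r hr p).trans hp, fun x => ?_⟩
  change _ = f (q x)
  rw [← hpf, MvPolynomial.aeval_def, MvPolynomial.algebraMap_eq, MvPolynomial.eval_eval₂]
  simp only [MvPolynomial.eval₂_eq', MvPolynomial.eval_eq', hrq]
  simp

end PolyLE

end SepNoether

/-! ### Semi-invariants of the faithful two-dimensional modules -/

namespace SL23

open Matrix SepNoether

/-- A square root of `-1` and a primitive cube root of unity in a field of characteristic
different from `2` and `3`. -/
structure Roots (F : Type*) [Field F] where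
  ι : F
  ω : F
  hι : ι * ι = -1
  hω : ω * ω + ω + 1 = 0
  h2 : (2 : F) ≠ 0
  h3 : (3 : F) ≠ 0

namespace Roots

variable {F : Type*} [Field F] (R : Roots F)

theorem ω_cube : R.ω ^ 3 = 1 := by linear_combination (R.ω - 1) * R.hω

theorem ω_ne_one : R.ω ≠ 1 := fun h => R.h3 (by
  have := R.hω
  rw [h] at this
  linear_combination this)

theorem h4 (R : Roots F) : (4 : F) ≠ 0 := by
  have : (4 : F) = 2 * 2 := by norm_num
  rw [this]; exact mul_ne_zero R.h2 R.h2

/-- The character of order three. -/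
def char : SL23 →* F where
  toFun g := R.ω ^ (cls g).val
  map_one' := by simp [cls_one]
  map_mul' g h := by
    rw [cls_mul, ZMod.val_add, ← pow_add]
    conv_rhs => rw [← Nat.div_add_mod ((cls g).val + (cls h).val) 3, pow_add, pow_mul, R.ω_cube,
      one_pow, one_mul]

theorem char_of_cls_eq_zero {g : SL23} (hg : cls g = 0) : R.char g = 1 := by
  simp [char, hg]

theorem char_cube (g : SL23) : R.char g ^ 3 = 1 := by
  simp only [char, MonoidHom.coe_mk, OneHom.coe_mk]
  rw [← pow_mul, mul_comm, pow_mul, R.ω_cube, one_pow]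

theorem char_eq_one_iff {g : SL23} : R.char g = 1 ↔ cls g = 0 := by
  refine ⟨fun h => ?_, R.char_of_cls_eq_zero⟩
  change R.ω ^ (cls g).val = 1 at h
  generalize cls g = c at h
  have h' := R.ω_ne_one
  fin_cases c
  · rfl
  · exact absurd ((pow_one _).symm.trans h) h'
  · have : R.ω ^ 2 = 1 := h
    exact absurd (by linear_combination R.ω_cube - R.ω * this) h'

theorem char_qu : R.char qu = R.ω := by
  simp only [char, MonoidHom.coe_mk, OneHom.coe_mk, cls_qu]
  exact pow_one _

/-- The representation by Hurwitz units. -/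
abbrev hur : SL23 →* Matrix (Fin 2) (Fin 2) F := rho R.ι R.hι R.h2

/-- The representation by Hurwitz units, twisted by a power of the character of order three. -/
def twist (k : ℕ) : SL23 →* Matrix (Fin 2) (Fin 2) F where
  toFun g := R.char g ^ k • R.hur g
  map_one' := by simp
  map_mul' g h := by simp [mul_pow, smul_smul, mul_comm]

theorem twist_mulVec (k : ℕ) (g : SL23) (a : Fin 2 → F) :
    R.twist k g *ᵥ a = R.char g ^ k • (R.hur g *ᵥ a) := by
  simp [twist, Matrix.smul_mulVec]

theorem twist_of_cls_eq_zero (k : ℕ) {g : SL23} (hg : cls g = 0) : R.twist k g = R.hur g := by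
  simp [twist, R.char_of_cls_eq_zero hg]

/-- The square root `ω - ω ^ 2` of `-3`. -/
def θ : F := 2 * R.ω + 1

theorem θ_sq : R.θ * R.θ = -3 := by
  rw [θ]
  linear_combination 4 * R.hω

theorem θ_ne_zero : R.θ ≠ 0 := fun h => R.h3 (by
  have := R.θ_sq
  rw [h] at this
  linear_combination this)

/-- The quartic semi-invariant with character `χ`. -/
def quarticP (a : Fin 2 → F) : F := a 0 ^ 4 + a 1 ^ 4 + 2 * R.θ * (a 0 ^ 2 * a 1 ^ 2)
/-- The quartic semi-invariant with character `χ ^ 2`. -/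
def quarticQ (a : Fin 2 → F) : F := a 0 ^ 4 + a 1 ^ 4 - 2 * R.θ * (a 0 ^ 2 * a 1 ^ 2)
/-- The invariant of degree six. -/
def _root_.SL23.sextic (a : Fin 2 → F) : F := a 0 * a 1 * (a 0 ^ 4 - a 1 ^ 4)

/-- It suffices to check generators. The element `qu` mixes x^4 + y^4 and x^2 y^2 linearly; the two
quartics are the eigenvectors, with eigenvalues ω and ω^2. -/
theorem semiinvariants_hur (g : SL23) : ∀ a : Fin 2 → F,
    R.quarticP (R.hur g *ᵥ a) = R.char g * R.quarticP a ∧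
    R.quarticQ (R.hur g *ᵥ a) = R.char g ^ 2 * R.quarticQ a ∧
    sextic (R.hur g *ᵥ a) = sextic a := by
  have hι := R.hι
  have hι4 : R.ι ^ 4 = 1 := by linear_combination (R.ι * R.ι - 1) * hι
  induction g using SL23.induction_on with
  | one => simp
  | i =>
    intro a
    rw [rho_qi, R.char_of_cls_eq_zero cls_qi]
    simp only [quarticP, quarticQ, sextic, cons_val_zero, cons_val_one]
    refine ⟨?_, ?_, ?_⟩
    · linear_combination (a 0 ^ 4 + a 1 ^ 4 + 2 * R.θ * (a 0 ^ 2 * a 1 ^ 2)) * hι4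
    · linear_combination (a 0 ^ 4 + a 1 ^ 4 - 2 * R.θ * (a 0 ^ 2 * a 1 ^ 2)) * hι4
    · linear_combination -(R.ι ^ 4 * a 0 * a 1 * (a 0 ^ 4 - a 1 ^ 4)) * hι +
        a 0 * a 1 * (a 0 ^ 4 - a 1 ^ 4) * hι4
  | j =>
    intro a
    rw [rho_qj, R.char_of_cls_eq_zero cls_qj]
    simp only [quarticP, quarticQ, sextic, cons_val_zero, cons_val_one]
    refine ⟨by ring, by ring, by ring⟩
  | u =>
    intro a
    rw [rho_qu, R.char_qu]
    simp only [quarticP, quarticQ, sextic, cons_val_zero, cons_val_one]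
    have h2 := R.h2
    have h4 := R.h4
    have e1 : ((1 + R.ι) / 2) ^ 4 = -1 / 4 := by
      field_simp
      linear_combination 4 * (R.ι ^ 2 + 4 * R.ι + 5) * hι
    have e2 : ((R.ι - 1) / 2) ^ 4 = -1 / 4 := by
      field_simp
      linear_combination 4 * (R.ι ^ 2 - 4 * R.ι + 5) * hι
    have e3 : (1 + R.ι) / 2 * ((R.ι - 1) / 2) = -1 / 2 := by
      field_simp
      linear_combination hι
    have e4 : ∀ z w : F, ((1 + R.ι) / 2 * z) ^ 2 * ((R.ι - 1) / 2 * w) ^ 2 =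
        1 / 4 * (z * w) ^ 2 := by
      intro z w
      rw [← mul_pow, mul_mul_mul_comm, e3]; field_simp; ring
    have hθ : R.ω = (R.θ - 1) / 2 := by rw [θ]; field_simp; ring
    have hω2 : R.ω ^ 2 = -(R.θ + 1) / 2 := by
      rw [θ]; field_simp; linear_combination 2 * R.hω
    have hθ2 := R.θ_sq
    set x := a 0
    set y := a 1
    have m4 : ∀ c d z : F, c ^ 4 = d → (c * z) ^ 4 = d * z ^ 4 := fun c d z h => by
      rw [mul_pow, h]
    refine ⟨?_, ?_, ?_⟩
    · rw [m4 _ _ _ e1, m4 _ _ _ e2, e4, hθ]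
      field_simp
      linear_combination (-8) * x ^ 2 * y ^ 2 * hθ2
    · rw [m4 _ _ _ e1, m4 _ _ _ e2, e4, hω2]
      field_simp
      linear_combination (-8) * x ^ 2 * y ^ 2 * hθ2
    · rw [m4 _ _ _ e1, m4 _ _ _ e2, mul_mul_mul_comm, e3]
      field_simp
      ring
  | mul g h hg hh =>
    intro a
    obtain ⟨p1, q1, t1⟩ := hg (R.hur h *ᵥ a)
    obtain ⟨p2, q2, t2⟩ := hh a
    rw [map_mul, map_mul, ← Matrix.mulVec_mulVec, p1, q1, t1, p2, q2, t2]
    refine ⟨by ring, by ring, rfl⟩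

theorem char_pow_six_mul (g : SL23) (k : ℕ) : R.char g ^ (6 * k) = 1 := by
  rw [show 6 * k = 3 * (2 * k) by ring, pow_mul, R.char_cube, one_pow]

/-- In degree four a twist by χ^k contributes χ^(4k). Modulo 3, the quartic P becomes invariant
exactly for k = 2, and Q exactly for k = 1, among k < 3. -/
theorem quarticP_twist (k : ℕ) (g : SL23) (a : Fin 2 → F) :
    R.quarticP (R.twist k g *ᵥ a) = R.char g ^ (4 * k + 1) * R.quarticP a := by
  rw [pow_succ, mul_assoc, ← (R.semiinvariants_hur g a).1, twist_mulVec]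
  simp only [quarticP, Pi.smul_apply, smul_eq_mul]
  ring

theorem quarticQ_twist (k : ℕ) (g : SL23) (a : Fin 2 → F) :
    R.quarticQ (R.twist k g *ᵥ a) = R.char g ^ (4 * k + 2) * R.quarticQ a := by
  rw [pow_add, mul_assoc, ← (R.semiinvariants_hur g a).2.1, twist_mulVec]
  simp only [quarticQ, Pi.smul_apply, smul_eq_mul]
  ring

theorem sextic_twist (k : ℕ) (g : SL23) (a : Fin 2 → F) :
    sextic (R.twist k g *ᵥ a) = sextic a := by
  rw [← (R.semiinvariants_hur g a).2.2, twist_mulVec]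
  simp only [sextic, Pi.smul_apply, smul_eq_mul]
  linear_combination ((R.hur g *ᵥ a) 0 * (R.hur g *ᵥ a) 1 *
    ((R.hur g *ᵥ a) 0 ^ 4 - (R.hur g *ᵥ a) 1 ^ 4)) * R.char_pow_six_mul g k

theorem eq_or_of_pow_four_eq {z w : F} (h : z ^ 4 = w ^ 4) :
    z = w ∨ z = -w ∨ z = R.ι * w ∨ z = -R.ι * w := by
  have : (z - w) * ((z + w) * ((z - R.ι * w) * (z + R.ι * w))) = 0 := by
    linear_combination h + (w ^ 4 - z ^ 2 * w ^ 2) * R.hι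
  rcases mul_eq_zero.1 this with h | h
  · exact Or.inl (sub_eq_zero.1 h)
  rcases mul_eq_zero.1 h with h | h
  · exact Or.inr (Or.inl (eq_neg_of_add_eq_zero_left h))
  rcases mul_eq_zero.1 h with h | h
  · exact Or.inr (Or.inr (Or.inl (sub_eq_zero.1 h)))
  · exact Or.inr (Or.inr (Or.inr (by rw [neg_mul]; exact eq_neg_of_add_eq_zero_left h)))

theorem exists_eq_pow_mul_of_cube_eq {z w : F} (h : z ^ 3 = w ^ 3) : ∃ m : ℕ, z = R.ω ^ m * w := by
  have : (z - w) * ((z - R.ω * w) * (z - R.ω ^ 2 * w)) = 0 := by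
    linear_combination h + (z * w ^ 2 - w * z ^ 2) * R.hω + (z * w ^ 2 - w ^ 3) * R.ω_cube
  rcases mul_eq_zero.1 this with h | h
  · exact ⟨0, by linear_combination h⟩
  rcases mul_eq_zero.1 h with h | h
  · exact ⟨1, by linear_combination h⟩
  · exact ⟨2, by linear_combination h⟩

/-- Only ±1 and ±i are needed: they act as diag(c, c⁻¹) with c^4 = 1. The scalar c is read off the
first coordinate, or off the second if the first is zero. -/
theorem exists_hur_of_pow_four_eq {a b : Fin 2 → F} (h0 : b 0 ^ 4 = a 0 ^ 4)
    (h1 : b 1 ^ 4 = a 1 ^ 4) (hm : b 0 * b 1 = a 0 * a 1) :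
    ∃ g, cls g = 0 ∧ R.hur g *ᵥ a = b := by
  have hι := R.hι
  have hι0 : R.ι ≠ 0 := by
    intro h
    rw [h] at hι
    simp at hι
  suffices ∃ c d : F, c * d = 1 ∧ (c = 1 ∨ c = -1 ∨ c = R.ι ∨ c = -R.ι) ∧ b 0 = c * a 0 ∧
      b 1 = d * a 1 by
    obtain ⟨c, d, hcd, hc, hb0, hb1⟩ := this
    have hbc : b = ![c * a 0, d * a 1] := by
      ext i; fin_cases i <;> simp [hb0, hb1]
    rw [hbc]
    rcases hc with rfl | rfl | rfl | rfl
    · refine ⟨1, cls_one, ?_⟩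
      have hd : d = 1 := by linear_combination hcd
      rw [map_one, Matrix.one_mulVec, hd]
      ext i; fin_cases i <;> simp
    · refine ⟨-1, cls_neg_one, ?_⟩
      have hd : d = -1 := by linear_combination -hcd
      rw [rho_neg_one, hd]
      ext i; fin_cases i <;> simp
    · refine ⟨qi, cls_qi, ?_⟩
      have hd : d = -R.ι := by linear_combination -R.ι * hcd + d * hι
      rw [rho_qi, hd]
    · refine ⟨-1 * qi, by rw [cls_mul, cls_neg_one, cls_qi, add_zero], ?_⟩
      have hd : d = R.ι := by linear_combination R.ι * hcd + d * hι
      rw [map_mul, ← Matrix.mulVec_mulVec, rho_qi, rho_neg_one, hd]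
      ext i; fin_cases i <;> simp
  by_cases ha : a 0 = 0
  · have hb : b 0 = 0 := by
      rw [ha] at h0
      exact pow_eq_zero_iff (by norm_num) |>.1 (h0.trans (by norm_num))
    rcases R.eq_or_of_pow_four_eq h1 with h | h | h | h
    · exact ⟨1, 1, by ring, by simp, by simp [ha, hb], by simp [h]⟩
    · exact ⟨-1, -1, by ring, by simp, by simp [ha, hb], by simp [h]⟩
    · exact ⟨-R.ι, R.ι, by linear_combination -hι, by simp, by simp [ha, hb], by simp [h]⟩
    · exact ⟨R.ι, -R.ι, by linear_combination -hι, by simp, by simp [ha, hb], by simp [h]⟩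
  · rcases R.eq_or_of_pow_four_eq h0 with h | h | h | h
    · refine ⟨1, 1, by ring, by simp, by simp [h], mul_left_cancel₀ ha ?_⟩
      rw [h] at hm; linear_combination hm
    · refine ⟨-1, -1, by ring, by simp, by simp [h], mul_left_cancel₀ ha ?_⟩
      rw [h] at hm; linear_combination -hm
    · refine ⟨R.ι, -R.ι, by linear_combination -hι, by simp, by simp [h], mul_left_cancel₀ ha ?_⟩
      rw [h] at hm; linear_combination -R.ι * hm + a 0 * b 1 * hι
    · refine ⟨-R.ι, R.ι, by linear_combination -hι, by simp, by simp [h], mul_left_cancel₀ ha ?_⟩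
      rw [h] at hm; linear_combination R.ι * hm + a 0 * b 1 * hι

/-- The quartics and the sextic separate the orbits of the quaternion group. -/
theorem exists_hur_of_semiinvariants_eq {a b : Fin 2 → F} (hP : R.quarticP a = R.quarticP b)
    (hQ : R.quarticQ a = R.quarticQ b) (hT : sextic a = sextic b) :
    ∃ g, cls g = 0 ∧ R.hur g *ᵥ a = b := by
  simp only [quarticP, quarticQ, sextic] at hP hQ hT
  have hs : b 0 ^ 4 + b 1 ^ 4 = a 0 ^ 4 + a 1 ^ 4 :=
    mul_left_cancel₀ R.h2 (by linear_combination -hP - hQ)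
  have hp : (b 0 * b 1) ^ 2 = (a 0 * a 1) ^ 2 :=
    mul_left_cancel₀ (mul_ne_zero R.h4 R.θ_ne_zero) (by linear_combination -hP + hQ)
  have id_case : b 0 ^ 4 = a 0 ^ 4 → b 0 * b 1 = a 0 * a 1 → ∃ g, cls g = 0 ∧ R.hur g *ᵥ a = b :=
    fun h h' => R.exists_hur_of_pow_four_eq h (by linear_combination hs - h) h'
  have qj_case : b 0 ^ 4 = a 1 ^ 4 → b 0 * b 1 = -(a 0 * a 1) →
      ∃ g, cls g = 0 ∧ R.hur g *ᵥ a = b := by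
    intro h h'
    obtain ⟨g, hg, hgb⟩ := R.exists_hur_of_pow_four_eq (a := R.hur qj *ᵥ a) (b := b)
      (by rw [rho_qj]; simpa using h)
      (by rw [rho_qj]; simp; linear_combination hs - h)
      (by rw [rho_qj]; simp; linear_combination h')
    exact ⟨g * qj, by rw [cls_mul, hg, cls_qj, add_zero], by
      rw [map_mul, ← Matrix.mulVec_mulVec, hgb]⟩
  -- The fourth powers of the coordinates of a and of b have the same sum and product, so they agree
  -- up to order.
  have hprod : (b 0 ^ 4 - a 0 ^ 4) * (b 0 ^ 4 - a 1 ^ 4) = 0 := by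
    linear_combination b 0 ^ 4 * hs - ((b 0 * b 1) ^ 2 + (a 0 * a 1) ^ 2) * hp
  have hsgn : b 0 * b 1 = a 0 * a 1 ∨ b 0 * b 1 = -(a 0 * a 1) := sq_eq_sq_iff_eq_or_eq_neg.1 hp
  rcases mul_eq_zero.1 hprod with h | h
  · rcases hsgn with h' | h'
    · exact id_case (by linear_combination h) h'
    · rw [h'] at hT
      -- With mismatched order and sign the sextic would change sign, so it vanishes. Then either
      -- the sign or the order is immaterial.
      have : a 0 * a 1 * (2 * (a 0 ^ 4 - a 1 ^ 4)) = 0 := by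
        linear_combination hT + a 0 * a 1 * (hs - 2 * h)
      rcases mul_eq_zero.1 this with h0 | h0
      · exact id_case (by linear_combination h) (by rw [h', h0, neg_zero])
      · have := (mul_eq_zero.1 h0).resolve_left R.h2
        exact qj_case (by linear_combination h + this) h'
  · rcases hsgn with h' | h'
    · rw [h'] at hT
      have : a 0 * a 1 * (2 * (a 0 ^ 4 - a 1 ^ 4)) = 0 := by
        linear_combination hT + a 0 * a 1 * (2 * h - hs)
      rcases mul_eq_zero.1 this with h0 | h0
      · exact qj_case (by linear_combination h) (by rw [h', h0, neg_zero])
      · have := (mul_eq_zero.1 h0).resolve_left R.h2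
        exact id_case (by linear_combination h - this) h'
    · exact qj_case (by linear_combination h) h'

end Roots

end SL23

/-! ### Orbits, stabilizers and cutting polynomials in dimension two -/

namespace SL23

open Matrix SepNoether

namespace Roots

variable {F : Type*} [Field F] (R : Roots F)

theorem polyLE_quarticP : PolyLE 4 R.quarticP :=
  ((((PolyLE.coord 0).pow 4).add ((PolyLE.coord 1).pow 4)).add
    ((((PolyLE.coord 0).pow 2).mul ((PolyLE.coord 1).pow 2)).const_mul _))

theorem polyLE_quarticQ : PolyLE 4 R.quarticQ :=
  ((((PolyLE.coord 0).pow 4).add ((PolyLE.coord 1).pow 4)).sub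
    ((((PolyLE.coord 0).pow 2).mul ((PolyLE.coord 1).pow 2)).const_mul _))

theorem polyLE_sextic : PolyLE 6 (sextic (F := F)) :=
  ((PolyLE.coord 0).mul (PolyLE.coord 1)).mul
    (((PolyLE.coord 0).pow 4).sub ((PolyLE.coord 1).pow 4))

/-- Two points of a two-dimensional module of the binary tetrahedral group with the same
invariants of degree at most twelve lie in the same orbit. -/
theorem exists_twist_mulVec_eq {k : ℕ} (hk : k < 3) {a b : Fin 2 → F}
    (h : ∀ f : (Fin 2 → F) → F, PolyLE 12 f → (∀ g x, f (R.twist k g *ᵥ x) = f x) → f a = f b) :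
    ∃ g, R.twist k g *ᵥ a = b := by
  have hT : sextic a = sextic b :=
    h _ (polyLE_sextic.mono (by norm_num)) (R.sextic_twist k)
  have hP : R.quarticP b ^ 3 = R.quarticP a ^ 3 :=
    (h _ (R.polyLE_quarticP.pow 3) fun g x => by
      rw [R.quarticP_twist, mul_pow, ← pow_mul, mul_comm (4 * k + 1), pow_mul, R.char_cube,
        one_pow, one_mul]).symm
  have hQ : R.quarticQ b ^ 3 = R.quarticQ a ^ 3 :=
    (h _ (R.polyLE_quarticQ.pow 3) fun g x => by
      rw [R.quarticQ_twist, mul_pow, ← pow_mul, mul_comm (4 * k + 2), pow_mul, R.char_cube,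
        one_pow, one_mul]).symm
  obtain ⟨p, hp⟩ := R.exists_eq_pow_mul_of_cube_eq hP
  obtain ⟨q, hq⟩ := R.exists_eq_pow_mul_of_cube_eq hQ
  -- The cubes of the quartics fix each quartic up to a cube root of unity. If a single power of
  -- `qu` corrects both, the quaternion group does the rest.
  suffices ∃ m : ℕ, R.quarticP b = R.ω ^ (m * (4 * k + 1)) * R.quarticP a ∧
      R.quarticQ b = R.ω ^ (m * (4 * k + 2)) * R.quarticQ a by
    obtain ⟨m, hmP, hmQ⟩ := this
    have hc : R.char (qu ^ m) = R.ω ^ m := by rw [map_pow, R.char_qu]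
    obtain ⟨g, hg, hgb⟩ := R.exists_hur_of_semiinvariants_eq (a := R.twist k (qu ^ m) *ᵥ a) (b := b)
      (by rw [R.quarticP_twist, hc, hmP, pow_mul]) (by rw [R.quarticQ_twist, hc, hmQ, pow_mul])
      (by rw [R.sextic_twist, hT])
    exact ⟨g * qu ^ m, by
      rw [map_mul, ← Matrix.mulVec_mulVec, R.twist_of_cls_eq_zero k hg, hgb]⟩
  have hω3 := R.ω_cube
  have hpow : ∀ m c : ℕ, R.ω ^ (3 * c + m) = R.ω ^ m := fun m c => by
    rw [pow_add, pow_mul, hω3, one_pow, one_mul]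
  interval_cases k
  -- For k = 0 the invariant P Q of degree 8 links the two cube roots of unity. For k = 1 and k = 2
  -- one quartic is itself invariant, and the other alone determines m.
  · have hPQ : R.quarticP a * R.quarticQ a = R.quarticP b * R.quarticQ b :=
      h _ ((R.polyLE_quarticP.mul R.polyLE_quarticQ).mono (by norm_num)) fun g x => by
        rw [R.quarticP_twist, R.quarticQ_twist]
        linear_combination R.quarticP x * R.quarticQ x * R.char_cube g
    by_cases h0 : R.quarticP a = 0
    · refine ⟨2 * q, by rw [hp, h0, mul_zero, mul_zero], ?_⟩
      rw [hq, show 2 * q * (4 * 0 + 2) = 3 * q + q by ring, hpow]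
    · refine ⟨p, by rw [hp]; simp, ?_⟩
      rw [hp] at hPQ
      have hw : R.ω ^ p ≠ 0 := pow_ne_zero _ fun h => by simp [h] at hω3
      apply mul_left_cancel₀ (mul_ne_zero hw h0)
      rw [← hPQ]
      have : R.ω ^ p * R.ω ^ (p * (4 * 0 + 2)) = 1 := by
        rw [← pow_add, show p + p * (4 * 0 + 2) = 3 * p + 0 by ring, hpow, pow_zero]
      linear_combination -(R.quarticP a * R.quarticQ a) * this
  · have hQ1 : R.quarticQ a = R.quarticQ b :=
      h _ (R.polyLE_quarticQ.mono (by norm_num)) fun g x => by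
        rw [R.quarticQ_twist, R.char_pow_six_mul g 1, one_mul]
    refine ⟨2 * p, ?_, ?_⟩
    · rw [hp, show 2 * p * (4 * 1 + 1) = 3 * (3 * p) + p by ring, hpow]
    · rw [← hQ1, show 2 * p * (4 * 1 + 2) = 3 * (4 * p) + 0 by ring, hpow, pow_zero, one_mul]
  · have hP1 : R.quarticP a = R.quarticP b :=
      h _ (R.polyLE_quarticP.mono (by norm_num)) fun g x => by
        rw [R.quarticP_twist, show 4 * 2 + 1 = 3 * 3 by norm_num, pow_mul, R.char_cube, one_pow,
          one_mul]
    refine ⟨q, ?_, ?_⟩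
    · rw [← hP1, show q * (4 * 2 + 1) = 3 * (3 * q) + 0 by ring, hpow, pow_zero, one_mul]
    · rw [hq, show q * (4 * 2 + 2) = 3 * (3 * q) + q by ring, hpow]

/-- The quaternion group acts freely on nonzero points. -/
theorem eq_one_of_hur_mulVec_eq {g : SL23} (hg : cls g = 0) {a : Fin 2 → F} (ha : a ≠ 0)
    (h : R.hur g *ᵥ a = a) : g = 1 := by
  have hι := R.hι
  have key : ∀ x : F, x = -x → x = 0 := fun x hx => by
    have : 2 * x = 0 := by linear_combination hx
    exact (mul_eq_zero.1 this).resolve_left R.h2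
  by_contra hne
  apply ha
  suffices a 0 = 0 ∧ a 1 = 0 by
    ext i; fin_cases i
    exacts [this.1, this.2]
  rcases rho_of_cls_eq_zero R.ι R.hι R.h2 hg a with (rfl | rfl) | ⟨s, hs, h' | h' | h'⟩
  · exact absurd rfl hne
  · rw [rho_neg_one] at h
    have h0 := congrFun h 0
    have h1 := congrFun h 1
    exact ⟨key _ h0.symm, key _ h1.symm⟩
  all_goals
    rw [h'] at h
    have h0 := congrFun h 0
    have h1 := congrFun h 1
    simp only [cons_val_zero, cons_val_one] at h0 h1
  · exact ⟨key _ (by linear_combination (-1 - s * R.ι) * h0 + s * s * a 0 * hι - a 0 * hs),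
      key _ (by linear_combination (-1 + s * R.ι) * h1 + s * s * a 1 * hι - a 1 * hs)⟩
  · exact ⟨key _ (by linear_combination -h0 - s * h1 - a 0 * hs),
      key _ (by linear_combination -h1 + s * h0 - a 1 * hs)⟩
  · exact ⟨key _ (by linear_combination -h0 - s * R.ι * h1 + s * s * a 0 * hι - a 0 * hs),
      key _ (by linear_combination -h1 - s * R.ι * h0 + s * s * a 1 * hι - a 1 * hs)⟩

open Classical in
/-- The stabilizer of a point of a two-dimensional module, as a finite set. -/
noncomputable def stab (k : ℕ) (a : Fin 2 → F) : Finset SL23 :=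
  Finset.univ.filter fun g => R.twist k g *ᵥ a = a

theorem mem_stab {k : ℕ} {a : Fin 2 → F} {g : SL23} :
    g ∈ R.stab k a ↔ R.twist k g *ᵥ a = a := by
  simp [stab]

theorem one_mem_stab (k : ℕ) (a : Fin 2 → F) : 1 ∈ R.stab k a := by
  simp [mem_stab]

theorem mul_mem_stab_iff {k : ℕ} {a : Fin 2 → F} {g h : SL23} (hh : h ∈ R.stab k a) :
    g * h ∈ R.stab k a ↔ g ∈ R.stab k a := by
  rw [mem_stab] at hh
  rw [mem_stab, mem_stab, map_mul, ← Matrix.mulVec_mulVec, hh]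

theorem inv_mem_stab {k : ℕ} {a : Fin 2 → F} {g : SL23} (hg : g ∈ R.stab k a) :
    g⁻¹ ∈ R.stab k a := by
  rw [← R.mul_mem_stab_iff hg, inv_mul_cancel]
  exact R.one_mem_stab k a

theorem eq_one_of_mem_stab {k : ℕ} {a : Fin 2 → F} (ha : a ≠ 0) {g : SL23} (hg : g ∈ R.stab k a)
    (h0 : cls g = 0) : g = 1 := by
  rw [mem_stab, R.twist_of_cls_eq_zero k h0] at hg
  exact R.eq_one_of_hur_mulVec_eq h0 ha hg

/-- The stabilizer meets the quaternion group trivially, so it embeds in the quotient ℤ/3. -/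
theorem card_stab_le_three (k : ℕ) {a : Fin 2 → F} (ha : a ≠ 0) : (R.stab k a).card ≤ 3 := by
  have : (R.stab k a).card ≤ (Finset.univ : Finset (ZMod 3)).card := by
    refine Finset.card_le_card_of_injOn cls (fun _ _ => Finset.mem_coe.2 (Finset.mem_univ _)) ?_
    intro g hg h hh e
    have hmem : g * h⁻¹ ∈ R.stab k a := (R.mul_mem_stab_iff (R.inv_mem_stab hh)).2 hg
    have hcls : cls (g * h⁻¹) = 0 := by
      have h1 := cls_mul h h⁻¹
      rw [mul_inv_cancel, cls_one] at h1
      rw [cls_mul, e, ← h1]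
    exact mul_inv_eq_one.1 (R.eq_one_of_mem_stab ha hmem hcls)
  simpa using this

open Classical in
/-- `a` is cut out of its orbit by a polynomial whose degree is at most twelve minus the order of
the stabilizer. -/
def CutOut (k : ℕ) (a : Fin 2 → F) : Prop :=
  ∃ (d : ℕ) (D : (Fin 2 → F) → F), PolyLE d D ∧ d + (R.stab k a).card ≤ 12 ∧
    ∀ g, D (R.twist k g *ᵥ a) = if R.twist k g *ᵥ a = a then 1 else 0

/-- The quintic x (x^4 - y^4) vanishes at the orbit points off the axis. The geometric sum of degree
3 vanishes at (tα, 0) for t^4 = 1, t ≠ 1. The total degree 8 leaves room for a stabilizer of order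
3. -/
theorem cutOut_of_apply_one_eq_zero (k : ℕ) {α : F} (hα : α ≠ 0) : R.CutOut k ![α, 0] := by
  have h4 := R.h4
  have hne : ![α, 0] ≠ 0 := fun h => hα (congrFun h 0)
  refine ⟨8, fun x => x 0 * (x 0 ^ 4 - x 1 ^ 4) *
    (1 + x 0 / α + (x 0 / α) ^ 2 + (x 0 / α) ^ 3) / (4 * α ^ 5), ?_, ?_, fun g => ?_⟩
  · have hl : PolyLE 1 fun x : Fin 2 → F => x 0 / α := (PolyLE.coord 0).div_const _
    exact (((PolyLE.coord 0).mul (((PolyLE.coord 0).pow 4).sub ((PolyLE.coord 1).pow 4))).mul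
      ((((PolyLE.const 1).add (hl.mono (by norm_num))).add ((hl.pow 2).mono (by norm_num))).add
        (hl.pow 3))).div_const _
  · have := R.card_stab_le_three k hne
    omega
  · have hc : R.char g ≠ 0 := fun h => by
      have := R.char_cube g
      simp [h] at this
    rcases rho_axis R.ι R.hι R.h2 g α hα with ⟨hg, t, ht, h⟩ | ⟨h1, h2⟩
    · rw [R.twist_of_cls_eq_zero k hg, h]
      have ht0 : t ≠ 0 := fun h => by simp [h] at ht
      by_cases h1 : t = 1
      · subst h1
        simp
        field_simp
        norm_num
      · rw [if_neg]
        · have : 1 + t + t ^ 2 + t ^ 3 = 0 := by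
            apply mul_left_cancel₀ (sub_ne_zero.2 h1)
            linear_combination ht
          simp only [cons_val_zero, cons_val_one, mul_div_cancel_right₀ _ hα, this]
          simp
        · intro h
          apply h1
          have := congrFun h 0
          simp only [cons_val_zero] at this
          exact mul_right_cancel₀ hα (by rw [one_mul]; exact this)
    · rw [if_neg]
      · have : (R.twist k g *ᵥ ![α, 0]) 0 *
            ((R.twist k g *ᵥ ![α, 0]) 0 ^ 4 - (R.twist k g *ᵥ ![α, 0]) 1 ^ 4) = 0 := by
          rw [R.twist_mulVec]
          simp only [Pi.smul_apply, smul_eq_mul]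
          rcases h2 with h2 | h2
          · rw [h2]; ring
          · rw [mul_pow, mul_pow, h2]; ring
        simp only [this, zero_mul, zero_div]
      · rw [R.twist_mulVec]
        intro h
        have := congrFun h 1
        simp only [Pi.smul_apply, smul_eq_mul, cons_val_one] at this
        exact (mul_ne_zero (pow_ne_zero _ hc) h1) this

/-- A cubic that cuts out a point from its orbit under the quaternion group. -/
theorem exists_cubic {a : Fin 2 → F} (hT : sextic a ≠ 0) : ∃ D : (Fin 2 → F) → F, PolyLE 3 D ∧
    D a = 1 ∧ ∀ g, cls g = 0 → g ≠ 1 → D (R.hur g *ᵥ a) = 0 := by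
  have hι := R.hι
  have h2 := R.h2
  have h4 := R.h4
  have hx : a 0 ≠ 0 := fun h => hT (by simp [sextic, h])
  have hA : a 0 * a 1 ≠ 0 := fun h => hT (by simp [sextic, h])
  have hB : a 0 ^ 2 + a 1 ^ 2 ≠ 0 := fun h => hT (by
    rw [sextic]; linear_combination a 0 * a 1 * (a 0 ^ 2 - a 1 ^ 2) * h)
  have hC : a 0 ^ 2 - a 1 ^ 2 ≠ 0 := fun h => hT (by
    rw [sextic]; linear_combination a 0 * a 1 * (a 0 ^ 2 + a 1 ^ 2) * h)
  -- The forms xy, x^2 + y^2, x^2 - y^2 transform by the three nontrivial sign characters of the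
  -- quaternion group modulo ±1, and their product is the sextic. The averaged sum is thus the
  -- indicator of ±a, and the linear factor removes -a.
  refine ⟨fun x => (1 + x 0 * x 1 / (a 0 * a 1) + (x 0 ^ 2 + x 1 ^ 2) / (a 0 ^ 2 + a 1 ^ 2) +
    (x 0 ^ 2 - x 1 ^ 2) / (a 0 ^ 2 - a 1 ^ 2)) / 4 * ((1 + x 0 / a 0) / 2), ?_, ?_, ?_⟩
  · have c0 := PolyLE.coord (F := F) (0 : Fin 2)
    have c1 := PolyLE.coord (F := F) (1 : Fin 2)
    exact (((((PolyLE.const 1).add ((c0.mul c1).div_const _)).add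
      (((c0.pow 2).add (c1.pow 2)).div_const _)).add
      (((c0.pow 2).sub (c1.pow 2)).div_const _)).div_const _).mul
      (((PolyLE.const 1).add (c0.div_const _)).div_const _)
  · simp only [div_self hx, div_self hA, div_self hB, div_self hC]
    field_simp
    norm_num
  · intro g hg hne
    have e1 : ∀ z c : F, c ≠ 0 → z = -c → z / c = -1 := fun z c hc h => by
      rw [h, neg_div, div_self hc]
    rcases rho_of_cls_eq_zero R.ι R.hι R.h2 hg a with (rfl | rfl) | ⟨s, hs, h | h | h⟩
    · exact absurd rfl hne
    · rw [rho_neg_one]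
      simp only [Pi.neg_apply]
      rw [e1 (-a 0) _ hx rfl]
      ring
    all_goals
      rw [h]
      simp only [cons_val_zero, cons_val_one]
    · rw [show s * R.ι * a 0 * (-(s * R.ι) * a 1) = a 0 * a 1 by
          linear_combination -(s * s * a 0 * a 1) * hι + a 0 * a 1 * hs, div_self hA,
        e1 _ _ hB (by linear_combination s * s * (a 0 ^ 2 + a 1 ^ 2) * hι - (a 0 ^ 2 + a 1 ^ 2) * hs),
        e1 _ _ hC (by linear_combination s * s * (a 0 ^ 2 - a 1 ^ 2) * hι - (a 0 ^ 2 - a 1 ^ 2) * hs)]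
      ring
    · rw [e1 (s * a 1 * (-s * a 0)) _ hA (by linear_combination -(a 0 * a 1) * hs),
        show (s * a 1) ^ 2 + (-s * a 0) ^ 2 = a 0 ^ 2 + a 1 ^ 2 by
          linear_combination (a 0 ^ 2 + a 1 ^ 2) * hs, div_self hB,
        e1 _ _ hC (by linear_combination -(a 0 ^ 2 - a 1 ^ 2) * hs)]
      ring
    · rw [e1 (s * R.ι * a 1 * (s * R.ι * a 0)) _ hA
          (by linear_combination s * s * a 0 * a 1 * hι - a 0 * a 1 * hs),
        e1 _ _ hB (by linear_combination s * s * (a 0 ^ 2 + a 1 ^ 2) * hι - (a 0 ^ 2 + a 1 ^ 2) * hs),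
        show (s * R.ι * a 1) ^ 2 - (s * R.ι * a 0) ^ 2 = a 0 ^ 2 - a 1 ^ 2 by
          linear_combination -(s * s * (a 0 ^ 2 - a 1 ^ 2)) * hι + (a 0 ^ 2 - a 1 ^ 2) * hs,
        div_self hC]
      ring

theorem char_pow_eq_one_iff {g : SL23} {e : ℕ} (he : ¬ 3 ∣ e) :
    R.char g ^ e = 1 ↔ cls g = 0 := by
  rw [← R.char_eq_one_iff]
  refine ⟨fun h => ?_, fun h => by rw [h, one_pow]⟩
  have h3 := R.char_cube g
  have h' : R.char g ^ e = R.char g ^ (e % 3) := by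
    conv_lhs => rw [← Nat.div_add_mod e 3, pow_add, pow_mul, h3, one_pow, one_mul]
  rw [h'] at h
  have : e % 3 = 1 ∨ e % 3 = 2 := by omega
  rcases this with h1 | h1 <;> rw [h1] at h
  · simpa using h
  · linear_combination h3 - R.char g * h

/-- A semi-invariant quartic with nontrivial character that does not vanish at `a` distinguishes
the cosets of the quaternion group. -/
theorem cutOut_of_semiinvariant {k e : ℕ} {a : Fin 2 → F} (hT : sextic a ≠ 0)
    {f : (Fin 2 → F) → F} (hf : PolyLE 4 f) (he : ¬ 3 ∣ e)
    (hfe : ∀ g, f (R.twist k g *ᵥ a) = R.char g ^ e * f a) (hfa : f a ≠ 0) : R.CutOut k a := by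
  have ha : a ≠ 0 := fun h => hT (by simp [sextic, h])
  obtain ⟨D, hD, hD1, hD0⟩ := R.exists_cubic hT
  have hstab : ∀ g, R.twist k g *ᵥ a = a ↔ g = 1 := by
    refine fun g => ⟨fun hg => ?_, fun h => by rw [h, map_one, Matrix.one_mulVec]⟩
    refine R.eq_one_of_mem_stab ha (R.mem_stab.2 hg) ((R.char_pow_eq_one_iff he).1 ?_)
    have := hfe g
    rw [hg] at this
    exact mul_right_cancel₀ hfa (by rw [one_mul]; exact this.symm)
  refine ⟨11, fun x => (1 + f x / f a + (f x / f a) ^ 2) / 3 * D x, ?_, ?_, fun g => ?_⟩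
  · exact ((((PolyLE.const 1).add ((hf.div_const _).mono (by norm_num))).add
      ((hf.div_const _).pow 2)).div_const _).mul hD
  · have : R.stab k a = {1} := by ext g; rw [mem_stab, hstab, Finset.mem_singleton]
    rw [this]; simp
  · simp only [hfe, mul_div_cancel_right₀ _ hfa, hstab]
    by_cases hg : cls g = 0
    · rw [(R.char_pow_eq_one_iff he).2 hg, R.twist_of_cls_eq_zero k hg]
      by_cases h1 : g = 1
      · have h3 := R.h3
        rw [h1, if_pos rfl, map_one, Matrix.one_mulVec, hD1]
        field_simp
        norm_num
      · rw [if_neg h1, hD0 g hg h1, mul_zero]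
    · have hne : R.char g ^ e ≠ 1 := fun h => hg ((R.char_pow_eq_one_iff he).1 h)
      have h3 : (R.char g ^ e) ^ 3 = 1 := by
        rw [← pow_mul, mul_comm, pow_mul, R.char_cube, one_pow]
      have h0 : 1 + R.char g ^ e + (R.char g ^ e) ^ 2 = 0 := by
        apply mul_left_cancel₀ (sub_ne_zero.2 hne)
        linear_combination h3
      rw [h0, if_neg fun h : g = 1 => hg (by rw [h, cls_one])]
      simp

/-- If neither quartic is both nonzero at a and of nontrivial character, both are constant on the
orbit of a. The orbit is then a single orbit of the quaternion group, and the cubic alone cuts out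
a. -/
theorem cutOut_of_sextic_ne_zero (k : ℕ) {a : Fin 2 → F} (hT : sextic a ≠ 0) : R.CutOut k a := by
  by_cases hP : R.quarticP a ≠ 0 ∧ ¬ 3 ∣ 4 * k + 1
  · exact R.cutOut_of_semiinvariant hT R.polyLE_quarticP hP.2 (R.quarticP_twist k · a) hP.1
  by_cases hQ : R.quarticQ a ≠ 0 ∧ ¬ 3 ∣ 4 * k + 2
  · exact R.cutOut_of_semiinvariant hT R.polyLE_quarticQ hQ.2 (R.quarticQ_twist k · a) hQ.1
  have ha : a ≠ 0 := fun h => hT (by simp [sextic, h])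
  have hchar : ∀ g e, 3 ∣ e → R.char g ^ e = 1 := by
    rintro g _ ⟨c, rfl⟩
    rw [pow_mul, R.char_cube, one_pow]
  have hPg : ∀ g, R.quarticP (R.twist k g *ᵥ a) = R.quarticP a := fun g => by
    rw [R.quarticP_twist]
    by_cases h : R.quarticP a = 0
    · rw [h, mul_zero]
    · rw [hchar _ _ (by_contra fun h' => hP ⟨h, h'⟩), one_mul]
  have hQg : ∀ g, R.quarticQ (R.twist k g *ᵥ a) = R.quarticQ a := fun g => by
    rw [R.quarticQ_twist]
    by_cases h : R.quarticQ a = 0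
    · rw [h, mul_zero]
    · rw [hchar _ _ (by_contra fun h' => hQ ⟨h, h'⟩), one_mul]
  obtain ⟨D, hD, hD1, hD0⟩ := R.exists_cubic hT
  refine ⟨3, D, hD, ?_, fun g => ?_⟩
  · have := R.card_stab_le_three k ha
    omega
  · obtain ⟨q, hq, hqa⟩ := R.exists_hur_of_semiinvariants_eq (hPg g).symm (hQg g).symm
      (R.sextic_twist k g a).symm
    rw [← hqa]
    by_cases h1 : q = 1
    · rw [h1, map_one, Matrix.one_mulVec, if_pos rfl, hD1]
    · rw [if_neg fun h => h1 (R.eq_one_of_hur_mulVec_eq hq ha h), hD0 q hq h1]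

/-- The points on the zero set of the sextic can be moved to the first coordinate axis. -/
theorem exists_apply_one_eq_zero (k : ℕ) {a : Fin 2 → F} (hT : sextic a = 0) :
    ∃ g, (R.twist k g *ᵥ a) 1 = 0 := by
  have hι := R.hι
  suffices ∃ g, (R.hur g *ᵥ a) 1 = 0 by
    obtain ⟨g, hg⟩ := this
    exact ⟨g, by rw [R.twist_mulVec, Pi.smul_apply, hg, smul_zero]⟩
  -- The six linear factors of the sextic define six lines, each of which is carried to the first
  -- axis by an explicit element.
  have : a 0 * (a 1 * ((a 0 - a 1) * ((a 0 + a 1) *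
      ((a 0 - R.ι * a 1) * (a 0 + R.ι * a 1))))) = 0 := by
    rw [sextic] at hT
    linear_combination hT - a 0 * a 1 * (a 0 ^ 2 - a 1 ^ 2) * a 1 ^ 2 * hι
  rcases mul_eq_zero.1 this with h | h
  · exact ⟨qj, by rw [rho_qj]; simp [h]⟩
  rcases mul_eq_zero.1 h with h | h
  · exact ⟨1, by rw [map_one, Matrix.one_mulVec, h]⟩
  rcases mul_eq_zero.1 h with h | h
  · exact ⟨qu, by rw [rho_qu]; simp [h]⟩
  rcases mul_eq_zero.1 h with h | h
  · refine ⟨qu * qi, ?_⟩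
    rw [map_mul, ← Matrix.mulVec_mulVec, rho_qi, rho_qu]
    simp only [cons_val_one, cons_val_zero]
    linear_combination (R.ι - 1) / 2 * R.ι * h
  rcases mul_eq_zero.1 h with h | h
  · refine ⟨qu * (qu * qi), ?_⟩
    rw [map_mul, map_mul, ← Matrix.mulVec_mulVec, ← Matrix.mulVec_mulVec, rho_qi, rho_qu, rho_qu]
    simp only [cons_val_one, cons_val_zero]
    have h2 := R.h2
    field_simp
    linear_combination 2 * (R.ι - 1) * R.ι * h
  · refine ⟨qu * qu, ?_⟩
    rw [map_mul, ← Matrix.mulVec_mulVec, rho_qu, rho_qu]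
    simp only [cons_val_one, cons_val_zero]
    have h2 := R.h2
    field_simp
    linear_combination 2 * (R.ι - 1) * h

theorem exists_cutOut (k : ℕ) {a : Fin 2 → F} (ha : a ≠ 0) :
    ∃ g, R.CutOut k (R.twist k g *ᵥ a) := by
  by_cases hT : sextic a = 0
  · obtain ⟨g, hg⟩ := R.exists_apply_one_eq_zero k hT
    refine ⟨g, ?_⟩
    have e : R.twist k g *ᵥ a = ![(R.twist k g *ᵥ a) 0, 0] := by
      ext i; fin_cases i
      · rfl
      · exact hg
    rw [e]
    refine R.cutOut_of_apply_one_eq_zero k fun h => ha ?_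
    rw [h] at e
    have : R.twist k g⁻¹ *ᵥ (R.twist k g *ᵥ a) = a := by
      rw [Matrix.mulVec_mulVec, ← map_mul, inv_mul_cancel, map_one, Matrix.one_mulVec]
    rw [← this, e]
    ext i; fin_cases i <;> simp
  · exact ⟨1, by rw [map_one, Matrix.one_mulVec]; exact R.cutOut_of_sextic_ne_zero k hT⟩

end Roots

end SL23

/-! ### Arbitrary modules: separating orbits by orbit sums -/

namespace SL23

open Matrix SepNoether

/-- A transversal of the centre. -/
def IsPositive (g : SL23) : Prop :=
  0 < hur0 g ∨ (hur0 g = 0 ∧ (0 < hur1 g ∨ (hur1 g = 0 ∧ (0 < hur2 g ∨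
    (hur2 g = 0 ∧ 0 < hur3 g)))))

instance : DecidablePred IsPositive := fun g => by unfold IsPositive; infer_instance

theorem isPositive_neg : ∀ g : SL23, IsPositive (-g) ↔ ¬ IsPositive g := by decide +kernel

theorem card_isPositive : (Finset.univ.filter IsPositive).card = 12 := by decide +kernel

theorem isPositive_one : IsPositive 1 := by decide +kernel

theorem neg_one_ne_one : (-1 : SL23) ≠ 1 := by decide +kernel

/-- The product over the quotient by the centre is invariant under translations. -/
theorem prod_isPositive_mul_right {M : Type*} [CommMonoid M] (φ : SL23 → M)
    (hφ : ∀ g, φ (-g) = φ g) (h : SL23) :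
    ∏ g ∈ Finset.univ.filter IsPositive, φ (g * h) = ∏ g ∈ Finset.univ.filter IsPositive, φ g := by
  -- The map r picks the positive element of {g, -g}; translation followed by r permutes the
  -- transversal.
  let r : SL23 → SL23 := fun g => if IsPositive g then g else -g
  have hr : ∀ g, IsPositive (r g) := fun g => by
    by_cases hg : IsPositive g
    · simp only [r, if_pos hg, hg]
    · simp only [r, if_neg hg, isPositive_neg, hg, not_false_eq_true]
  have hφr : ∀ g, φ (r g) = φ g := fun g => by
    by_cases hg : IsPositive g
    · simp only [r, if_pos hg]
    · simp only [r, if_neg hg, hφ]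
  have hrr : ∀ g h, IsPositive g → r (r (g * h) * h⁻¹) = g := fun g h hg => by
    by_cases hgh : IsPositive (g * h)
    · simp only [r, if_pos hgh, mul_inv_cancel_right, if_pos hg]
    · have hng : ¬ IsPositive (-g) := by rw [isPositive_neg, not_not]; exact hg
      simp only [r, if_neg hgh, neg_mul, mul_inv_cancel_right, if_neg hng, neg_neg]
  refine Finset.prod_nbij' (fun g => r (g * h)) (fun g => r (g * h⁻¹)) ?_ ?_ ?_ ?_ ?_
  · intro g _
    simpa using hr _
  · intro g _
    simpa using hr _
  · intro g hg
    exact hrr g h (by simpa using hg)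
  · intro g hg
    simpa using hrr g h⁻¹ (by simpa using hg)
  · intro g _
    exact (hφr _).symm

variable {F : Type*} [Field F] {n : ℕ}

/-- The orbit sums of all polynomials of degree at most twelve agree at `v` and `w`. -/
def SameMoments (Ψ : SL23 →* Matrix (Fin n) (Fin n) F) (v w : Fin n → F) : Prop :=
  ∀ f : (Fin n → F) → F, PolyLE 12 f → ∑ g, f (Ψ g *ᵥ v) = ∑ g, f (Ψ g *ᵥ w)

variable {Ψ : SL23 →* Matrix (Fin n) (Fin n) F} {v w : Fin n → F}

theorem SameMoments.symm (h : SameMoments Ψ v w) : SameMoments Ψ w v :=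
  fun f hf => (h f hf).symm

theorem SameMoments.translate_left (h : SameMoments Ψ v w) (t : SL23) :
    SameMoments Ψ (Ψ t *ᵥ v) w := by
  intro f hf
  rw [← h f hf]
  simp only [Matrix.mulVec_mulVec, ← map_mul]
  exact Equiv.sum_comp (Equiv.mulRight t) fun g => f (Ψ g *ᵥ v)

theorem SameMoments.apply_eq (h : SameMoments Ψ v w) (h24 : (24 : F) ≠ 0) {f : (Fin n → F) → F}
    (hf : PolyLE 12 f) (hv : ∀ g, f (Ψ g *ᵥ v) = f v) (hw : ∀ g, f (Ψ g *ᵥ w) = f w) :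
    f v = f w := by
  have := h f hf
  simp only [hv, hw, Finset.sum_const, Finset.card_univ, card_eq, nsmul_eq_mul] at this
  exact mul_left_cancel₀ h24 (by exact_mod_cast this)

theorem mulVec_inv_mulVec (Ψ : SL23 →* Matrix (Fin n) (Fin n) F) (g : SL23) (v : Fin n → F) :
    Ψ g *ᵥ (Ψ g⁻¹ *ᵥ v) = v := by
  rw [Matrix.mulVec_mulVec, ← map_mul, mul_inv_cancel, map_one, Matrix.one_mulVec]

/-- Over an infinite field one linear form can be chosen nonzero on all of the finitely many
differences w - g v, if none of them is zero. -/
theorem exists_mulVec_eq_of_linear [Infinite F]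
    (h : ∀ ℓ : (Fin n → F) →ₗ[F] F, ∃ g, ℓ w = ℓ (Ψ g *ᵥ v)) : ∃ g, Ψ g *ᵥ v = w := by
  by_contra! hne
  obtain ⟨ℓ, hℓ⟩ := Module.exists_dual_forall_apply_ne_zero (K := F)
    (fun g => w - Ψ g *ᵥ v) fun g => sub_ne_zero.2 (hne g).symm
  obtain ⟨g, hg⟩ := h ℓ
  apply hℓ g
  rw [map_sub, hg, sub_self]

theorem polyLE_linear_mulVec (ℓ : (Fin n → F) →ₗ[F] F) (g : SL23) :
    PolyLE 1 fun x => ℓ (Ψ g *ᵥ x) :=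
  PolyLE.linear (ℓ ∘ₗ (Ψ g).mulVecLin)

/-- The product of ℓ w - ℓ (g x) over G/{±1} has degree 12 and is constant on orbits of points fixed
by -1. It vanishes at w, hence at v. -/
theorem SameMoments.exists_mulVec_eq_of_neg_one [Infinite F] (h : SameMoments Ψ v w)
    (h24 : (24 : F) ≠ 0) (hv : Ψ (-1) *ᵥ v = v) (hw : Ψ (-1) *ᵥ w = w) : ∃ g, Ψ g *ᵥ v = w := by
  refine exists_mulVec_eq_of_linear fun ℓ => ?_
  let q : (Fin n → F) → F := fun x => ∏ g ∈ Finset.univ.filter IsPositive, (ℓ w - ℓ (Ψ g *ᵥ x))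
  have hq : PolyLE 12 q := by
    rw [← card_isPositive]
    exact PolyLE.prod _ fun g _ => (PolyLE.const _).sub (polyLE_linear_mulVec ℓ g)
  have inv : ∀ x, Ψ (-1) *ᵥ x = x → ∀ g, q (Ψ g *ᵥ x) = q x := by
    intro x hx t
    have := prod_isPositive_mul_right (fun g => ℓ w - ℓ (Ψ g *ᵥ x)) (fun g => by
      rw [← mul_neg_one, map_mul, ← Matrix.mulVec_mulVec, hx]) t
    simpa only [q, Matrix.mulVec_mulVec, ← map_mul] using this
  have hqw : q w = 0 :=
    Finset.prod_eq_zero (i := 1) (by simp [isPositive_one]) (by simp)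
  have hqv := h.apply_eq h24 hq (inv v hv) (inv w hw)
  rw [hqw] at hqv
  obtain ⟨g, -, hg⟩ := Finset.prod_eq_zero_iff.1 hqv
  exact ⟨g, sub_eq_zero.1 hg⟩

namespace Roots

variable (R : Roots F)

theorem h24 (R : Roots F) : (24 : F) ≠ 0 := by
  have : (24 : F) = 2 ^ 3 * 3 := by norm_num
  rw [this]; exact mul_ne_zero (pow_ne_zero _ R.h2) R.h3

/-- In the orbit sum of (D ∘ π) q only the stabilizer S of π v contributes, and q is constant along
S. The sums at v and w are therefore |S| q(v) and |S| q(w), with |S| ≤ 3 invertible and q(w) = 0. -/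
theorem exists_mulVec_eq_of_cutOut [Infinite F] (h : SameMoments Ψ v w) {k : ℕ}
    (π : (Fin n → F) →ₗ[F] Fin 2 → F) (hπ : ∀ g x, π (Ψ g *ᵥ x) = R.twist k g *ᵥ π x)
    (hπv : π v ≠ 0) (hvw : π v = π w) (hcut : R.CutOut k (π v)) : ∃ g, Ψ g *ᵥ v = w := by
  classical
  refine exists_mulVec_eq_of_linear fun ℓ => ?_
  obtain ⟨d, D, hD, hd, hval⟩ := hcut
  set S := R.stab k (π v) with hS
  let q : (Fin n → F) → F := fun x => ∏ g ∈ S, (ℓ w - ℓ (Ψ g *ᵥ x))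
  have hq : PolyLE S.card q :=
    PolyLE.prod _ fun g _ => (PolyLE.const _).sub (polyLE_linear_mulVec ℓ g)
  have hDπ : PolyLE d fun x => D (π x) :=
    hD.comp fun i => PolyLE.linear (LinearMap.proj i ∘ₗ π)
  have hqS : ∀ x, ∀ t ∈ S, q (Ψ t *ᵥ x) = q x := by
    intro x t ht
    simp only [q, Matrix.mulVec_mulVec, ← map_mul]
    refine Finset.prod_nbij' (fun g => g * t) (fun g => g * t⁻¹) ?_ ?_ ?_ ?_ ?_
    · exact fun g hg => (R.mul_mem_stab_iff ht).2 hg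
    · exact fun g hg => (R.mul_mem_stab_iff (R.inv_mem_stab ht)).2 hg
    · exact fun g _ => mul_inv_cancel_right g t
    · exact fun g _ => inv_mul_cancel_right g t
    · exact fun g _ => rfl
  have hsum : ∀ x, π x = π v → ∑ g, D (π (Ψ g *ᵥ x)) * q (Ψ g *ᵥ x) = S.card * q x := by
    intro x hx
    have : ∀ g, D (π (Ψ g *ᵥ x)) * q (Ψ g *ᵥ x) = if g ∈ S then q x else 0 := by
      intro g
      rw [hπ, hx, hval]
      by_cases hg : g ∈ S
      · rw [if_pos (R.mem_stab.1 hg), if_pos hg, one_mul, hqS x g hg]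
      · rw [if_neg fun h' => hg (R.mem_stab.2 h'), if_neg hg, zero_mul]
    simp only [this, Finset.sum_ite_mem, Finset.univ_inter, Finset.sum_const, nsmul_eq_mul]
  have hcard : (S.card : F) ≠ 0 := by
    have h3 := R.card_stab_le_three k hπv
    have h1 : 0 < S.card := Finset.card_pos.2 ⟨1, R.one_mem_stab k _⟩
    rw [← hS] at h3
    generalize S.card = c at h1 h3
    interval_cases c
    · simp
    · exact_mod_cast R.h2
    · exact_mod_cast R.h3
  have hqw : q w = 0 := Finset.prod_eq_zero (i := 1) (R.one_mem_stab k _) (by simp)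
  have hqv : q v = q w := by
    have := h _ ((hDπ.mul hq).mono hd)
    rw [hsum v rfl, hsum w hvw.symm] at this
    exact mul_left_cancel₀ hcard this
  rw [hqw] at hqv
  obtain ⟨g, -, hg⟩ := Finset.prod_eq_zero_iff.1 hqv
  exact ⟨g, sub_eq_zero.1 hg⟩

/-- The sum of the three faithful two-dimensional characters. -/
theorem sum_trace_twist (g : SL23) : ∑ k ∈ Finset.range 3, ∑ i, R.twist k g i i =
    (if g = 1 then 6 else 0) + (if g = -1 then -6 else 0) := by
  have h2 := R.h2
  have e : ∑ k ∈ Finset.range 3, ∑ i, R.twist k g i i =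
      (1 + R.char g + R.char g ^ 2) * (hur0 g : F) := by
    have : (R.hur g) 0 0 + (R.hur g) 1 1 = (hur0 g : F) := by
      simp only [rho, MonoidHom.coe_mk, OneHom.coe_mk, Matrix.of_apply, Matrix.cons_val',
        Matrix.cons_val_zero, Matrix.cons_val_one, Matrix.cons_val_fin_one]
      field_simp
      ring
    rw [← this]
    simp only [Finset.sum_range_succ, Finset.sum_range_zero, Fin.sum_univ_two, twist,
      MonoidHom.coe_mk, OneHom.coe_mk, Matrix.smul_apply, smul_eq_mul]
    ring
  rw [e]
  by_cases hg : cls g = 0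
  · rw [R.char_of_cls_eq_zero hg]
    have hne : ∀ c, hur0 g = c → c ≠ 2 → c ≠ -2 → g ≠ 1 ∧ g ≠ -1 := by
      rintro c hc h1 h1'
      refine ⟨fun h => h1 ?_, fun h => h1' ?_⟩
      · rw [← hc, h, hur_one.1]
      · rw [← hc, h, hur_neg_one.1]
    rcases hur_of_cls_eq_zero g hg with ⟨_, _, _, h⟩ | h | h | h
    · rcases h with ⟨h0, rfl⟩ | ⟨h0, rfl⟩
      · rw [h0, if_pos rfl, if_neg neg_one_ne_one.symm]; norm_num
      · rw [h0, if_pos rfl, if_neg neg_one_ne_one]; norm_num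
    all_goals
      obtain ⟨n1, n2⟩ := hne _ h.1 (by norm_num) (by norm_num)
      rw [if_neg n1, if_neg n2, h.1]
      simp
  · rw [if_neg fun h : g = 1 => hg (by rw [h, cls_one]),
      if_neg fun h : g = -1 => hg (by rw [h, cls_neg_one])]
    have hne : R.char g ≠ 1 := fun h => hg (R.char_eq_one_iff.1 h)
    have h0 : 1 + R.char g + R.char g ^ 2 = 0 := by
      apply mul_left_cancel₀ (sub_ne_zero.2 hne)
      linear_combination R.char_cube g
    rw [h0]; simp

/-- The equivariant map onto a two-dimensional module attached to a linear form and a vector. -/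
noncomputable def equivariantMap (Ψ : SL23 →* Matrix (Fin n) (Fin n) F) (k : ℕ)
    (ℓ : (Fin n → F) →ₗ[F] F) (e : Fin 2 → F) : (Fin n → F) →ₗ[F] Fin 2 → F :=
  ∑ g : SL23, (ℓ ∘ₗ (Ψ g⁻¹).mulVecLin).smulRight (R.twist k g *ᵥ e)

theorem equivariantMap_apply (k : ℕ) (ℓ : (Fin n → F) →ₗ[F] F) (e : Fin 2 → F) (x : Fin n → F) :
    R.equivariantMap Ψ k ℓ e x = ∑ g : SL23, ℓ (Ψ g⁻¹ *ᵥ x) • (R.twist k g *ᵥ e) := by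
  simp [equivariantMap]

theorem equivariantMap_mulVec (k : ℕ) (ℓ : (Fin n → F) →ₗ[F] F) (e : Fin 2 → F) (h : SL23)
    (x : Fin n → F) :
    R.equivariantMap Ψ k ℓ e (Ψ h *ᵥ x) = R.twist k h *ᵥ R.equivariantMap Ψ k ℓ e x := by
  rw [equivariantMap_apply, equivariantMap_apply, ← Equiv.sum_comp (Equiv.mulLeft h),
    Matrix.mulVec_sum]
  refine Finset.sum_congr rfl fun g _ => ?_
  rw [Equiv.coe_mulLeft, Matrix.mulVec_mulVec, ← map_mul, Matrix.mulVec_smul,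
    Matrix.mulVec_mulVec, ← map_mul]
  congr 4
  group

/-- If every equivariant map killed v, pairing g ↦ ℓ (g⁻¹ v) with the sum of the three faithful
characters would give 0. That sum is 6 at 1, -6 at -1 and 0 elsewhere, so v and (-1) v would have
equal coordinates. -/
theorem exists_equivariantMap_ne_zero (R : Roots F) (hv : Ψ (-1) *ᵥ v ≠ v) :
    ∃ k < 3, ∃ π : (Fin n → F) →ₗ[F] Fin 2 → F,
      (∀ g x, π (Ψ g *ᵥ x) = R.twist k g *ᵥ π x) ∧ π v ≠ 0 := by
  by_contra! hno
  apply hv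
  ext j
  let ℓ : (Fin n → F) →ₗ[F] F := LinearMap.proj j
  have h0 : ∀ k ∈ Finset.range 3, ∀ i, ∑ g, ℓ (Ψ g⁻¹ *ᵥ v) * R.twist k g i i = 0 := by
    intro k hk i
    have := congrFun (hno k (Finset.mem_range.1 hk) (R.equivariantMap Ψ k ℓ (Pi.single i 1))
      (R.equivariantMap_mulVec k ℓ _)) i
    rw [equivariantMap_apply] at this
    simpa [Finset.sum_apply] using this
  have hs : ∑ g, ℓ (Ψ g⁻¹ *ᵥ v) * ∑ k ∈ Finset.range 3, ∑ i, R.twist k g i i = 0 := by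
    simp only [Finset.mul_sum]
    rw [Finset.sum_comm]
    refine Finset.sum_eq_zero fun k hk => ?_
    rw [Finset.sum_comm]
    exact Finset.sum_eq_zero fun i _ => h0 k hk i
  simp only [R.sum_trace_twist, mul_add, Finset.sum_add_distrib, mul_ite, mul_zero,
    Finset.sum_ite_eq', Finset.mem_univ, if_true, inv_one, map_one, Matrix.one_mulVec] at hs
  have hinv : (-1 : SL23)⁻¹ = -1 := by decide +kernel
  rw [hinv] at hs
  have h6 : (6 : F) ≠ 0 := by
    have : (6 : F) = 2 * 3 := by norm_num
    rw [this]; exact mul_ne_zero R.h2 R.h3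
  change ℓ (Ψ (-1) *ᵥ v) = ℓ v
  exact mul_right_cancel₀ h6 (by linear_combination -hs)

/-- First v is translated until its image under π can be cut out, then w until the two images
coincide; equality of orbit sums survives both moves. -/
theorem exists_mulVec_eq_of_neg_one_ne (R : Roots F) [Infinite F] (h : SameMoments Ψ v w)
    (hv : Ψ (-1) *ᵥ v ≠ v) : ∃ g, Ψ g *ᵥ v = w := by
  obtain ⟨k, hk, π, hπ, hπv⟩ := R.exists_equivariantMap_ne_zero hv
  obtain ⟨t, ht⟩ := R.exists_cutOut k hπv
  rw [← hπ] at ht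
  have h' := h.translate_left t
  obtain ⟨g, hg⟩ := R.exists_twist_mulVec_eq hk (a := π (Ψ t *ᵥ v)) (b := π w) fun f hf hinv =>
    h'.apply_eq R.h24 (f := fun x => f (π x))
      (hf.comp fun i => PolyLE.linear (LinearMap.proj i ∘ₗ π))
      (fun g => by rw [hπ, hinv]) (fun g => by rw [hπ, hinv])
  have hw' : π (Ψ t *ᵥ v) = π (Ψ g⁻¹ *ᵥ w) := by
    rw [hπ g⁻¹ w, ← hg, Matrix.mulVec_mulVec, ← map_mul, inv_mul_cancel, map_one,
      Matrix.one_mulVec]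
  have hne : π (Ψ t *ᵥ v) ≠ 0 := by
    intro h0
    apply hπv
    have := hπ t⁻¹ (Ψ t *ᵥ v)
    rw [h0, Matrix.mulVec_zero, Matrix.mulVec_mulVec, ← map_mul, inv_mul_cancel, map_one,
      Matrix.one_mulVec] at this
    exact this
  obtain ⟨r, hr⟩ := R.exists_mulVec_eq_of_cutOut (h'.symm.translate_left g⁻¹).symm π hπ hne hw' ht
  refine ⟨g * (r * t), ?_⟩
  rw [map_mul, map_mul, ← Matrix.mulVec_mulVec, ← Matrix.mulVec_mulVec, hr, mulVec_inv_mulVec]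

/-- Two points at which the orbit sums of all polynomials of degree at most twelve agree lie in
the same orbit. -/
theorem exists_mulVec_eq (R : Roots F) [Infinite F] (h : SameMoments Ψ v w) : ∃ g, Ψ g *ᵥ v = w := by
  by_cases hv : Ψ (-1) *ᵥ v = v
  · by_cases hw : Ψ (-1) *ᵥ w = w
    · exact h.exists_mulVec_eq_of_neg_one R.h24 hv hw
    · obtain ⟨g, hg⟩ := R.exists_mulVec_eq_of_neg_one_ne h.symm hw
      refine ⟨g⁻¹, ?_⟩
      rw [← hg, Matrix.mulVec_mulVec, ← map_mul, inv_mul_cancel, map_one, Matrix.one_mulVec]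
  · exact R.exists_mulVec_eq_of_neg_one_ne h hv

end Roots

theorem exists_roots {K : Type*} [Field K] (h2 : (2 : K) ≠ 0) (h3 : (3 : K) ≠ 0) :
    Nonempty (Roots (AlgebraicClosure K)) := by
  have hinj := (algebraMap K (AlgebraicClosure K)).injective
  have h2' : (2 : AlgebraicClosure K) ≠ 0 := by
    rw [← map_ofNat (algebraMap K (AlgebraicClosure K)) 2]
    exact (map_ne_zero_iff _ hinj).2 h2
  have h3' : (3 : AlgebraicClosure K) ≠ 0 := by
    rw [← map_ofNat (algebraMap K (AlgebraicClosure K)) 3]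
    exact (map_ne_zero_iff _ hinj).2 h3
  obtain ⟨ι, hι⟩ := IsAlgClosed.exists_eq_mul_self (-1 : AlgebraicClosure K)
  obtain ⟨θ, hθ⟩ := IsAlgClosed.exists_eq_mul_self (-3 : AlgebraicClosure K)
  refine ⟨⟨ι, (θ - 1) / 2, hι.symm, ?_, h2', h3'⟩⟩
  field_simp
  linear_combination -hθ

end SL23

/-! ### Descent from the algebraic closure and the theorem -/

namespace SepNoether

open Matrix SL23

variable {K : Type*} [Field K] {n : ℕ}

/-- The sum of the translates of a polynomial is invariant. -/
theorem sum_polyAction_mem_invariants {G : Type*} [Group G] [Fintype G] (ψ : G →* GL (Fin n) K)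
    (f : MvPolynomial (Fin n) K) : ∑ g, polyAction ψ g f ∈ invariants ψ := by
  rw [mem_invariants_iff]
  intro h
  simp only [map_sum, polyAction_polyAction]
  exact Equiv.sum_comp (Equiv.mulLeft h) fun g => polyAction ψ g f

/-- By linearity monomials suffice, even for coefficients in L. The orbit sum of a monomial is the
value of an invariant defined over K, of no larger degree. -/
theorem sameMoments_of_invariants (ψ : SL23 →* GL (Fin n) K) {v w : Fin n → K}
    (h : ∀ f ∈ invariants ψ, f.totalDegree ≤ 12 → MvPolynomial.eval v f = MvPolynomial.eval w f)
    (L : Type*) [Field L] [Algebra K L] :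
    SameMoments ((algebraMap K L).mapMatrix.toMonoidHom.comp ((Units.coeHom _).comp ψ))
      (algebraMap K L ∘ v) (algebraMap K L ∘ w) := by
  have mono : ∀ s : Fin n →₀ ℕ, (s.sum fun _ e => e) ≤ 12 →
      ∑ g, ∏ i, ((ψ g : Matrix (Fin n) (Fin n) K) *ᵥ v) i ^ s i =
      ∑ g, ∏ i, ((ψ g : Matrix (Fin n) (Fin n) K) *ᵥ w) i ^ s i := by
    intro s hs
    have e : ∀ x, MvPolynomial.eval x (∑ g, polyAction ψ g (MvPolynomial.monomial s 1)) =
        ∑ g, ∏ i, ((ψ g : Matrix (Fin n) (Fin n) K) *ᵥ x) i ^ s i := by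
      intro x
      rw [map_sum, ← Equiv.sum_comp (Equiv.inv SL23)]
      refine Finset.sum_congr rfl fun g _ => ?_
      rw [eval_polyAction, Equiv.inv_apply, inv_inv, MvPolynomial.eval_monomial, one_mul,
        Finsupp.prod_fintype _ _ fun _ => pow_zero _]
    rw [← e, ← e]
    refine h _ (sum_polyAction_mem_invariants ψ _) ?_
    refine MvPolynomial.totalDegree_finsetSum_le fun g _ => ?_
    exact ((totalDegree_polyAction_le ψ g _).trans (MvPolynomial.totalDegree_monomial_le _ _)).trans
      hs
  rintro f ⟨p, hp, hpf⟩
  have hmap : ∀ (x : Fin n → K) (g : SL23), ((algebraMap K L).mapMatrix.toMonoidHom.comp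
      ((Units.coeHom _).comp ψ)) g *ᵥ (algebraMap K L ∘ x) =
      algebraMap K L ∘ ((ψ g : Matrix (Fin n) (Fin n) K) *ᵥ x) := by
    intro x g
    ext i
    exact (RingHom.map_mulVec (algebraMap K L) (ψ g : Matrix (Fin n) (Fin n) K) x i).symm
  have expand : ∀ x : Fin n → K, ∑ g, f (algebraMap K L ∘ ((ψ g : Matrix (Fin n) (Fin n) K) *ᵥ x)) =
      ∑ s ∈ p.support, p.coeff s *
        algebraMap K L (∑ g, ∏ i, ((ψ g : Matrix (Fin n) (Fin n) K) *ᵥ x) i ^ s i) := by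
    intro x
    simp only [← hpf, MvPolynomial.eval_eq', map_sum, Finset.mul_sum, map_prod, map_pow,
      Function.comp_apply]
    exact Finset.sum_comm
  simp only [hmap, expand]
  refine Finset.sum_congr rfl fun s hs => ?_
  rw [mono s ((MvPolynomial.le_totalDegree hs).trans hp)]

theorem orbit_eq_of_mulVec_eq {G : Type*} [Group G] (ψ : G →* GL (Fin n) K) {v w : Fin n → K}
    {g : G} (h : (ψ g : Matrix (Fin n) (Fin n) K) *ᵥ v = w) : orbit ψ v = orbit ψ w := by
  ext x
  constructor
  · rintro ⟨t, rfl⟩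
    refine ⟨t * g⁻¹, ?_⟩
    simp only [← h, Matrix.mulVec_mulVec, ← Units.val_mul, ← map_mul, inv_mul_cancel_right]
  · rintro ⟨t, rfl⟩
    refine ⟨t * g, ?_⟩
    simp only [← h, Matrix.mulVec_mulVec, ← Units.val_mul, ← map_mul]

/-- The algebraic closure supplies ω and an infinite field. The group element found there already
carries v to w over K, because K embeds injectively. -/
theorem betaSepModule_le_twelve (h2 : (2 : K) ≠ 0) (h3 : (3 : K) ≠ 0) (ψ : SL23 →* GL (Fin n) K) :
    betaSepModule ψ ≤ 12 := by
  refine iInf₂_le 12 ⟨by norm_num, fun f hf => hf.1, fun v w hvw => ?_⟩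
  by_contra! hno
  apply hvw
  obtain ⟨R⟩ := exists_roots h2 h3
  obtain ⟨g, hg⟩ := R.exists_mulVec_eq (sameMoments_of_invariants ψ (v := v) (w := w)
    (fun f hf hd => hno f ⟨hf, hd⟩) (AlgebraicClosure K))
  refine orbit_eq_of_mulVec_eq ψ (g := g) ?_
  ext i
  apply (algebraMap K (AlgebraicClosure K)).injective
  rw [RingHom.map_mulVec]
  exact congrFun hg i

theorem betaSepModule_comp {G H : Type*} [Group G] [Group H] (e : G ≃* H)
    (ψ : H →* GL (Fin n) K) : betaSepModule (ψ.comp e.toMonoidHom) = betaSepModule ψ := by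
  have hinv : invariants (ψ.comp e.toMonoidHom) = invariants ψ := by
    ext f
    rw [mem_invariants_iff, mem_invariants_iff]
    have key : ∀ g, polyAction (ψ.comp e.toMonoidHom) g = polyAction ψ (e g) := fun g => by
      simp [polyAction]
    simp only [key]
    exact (e.surjective.forall (p := fun h => polyAction ψ h f = f)).symm
  have horb : ∀ v, orbit (ψ.comp e.toMonoidHom) v = orbit ψ v := fun v =>
    e.surjective.range_comp fun h => (ψ h : Matrix (Fin n) (Fin n) K) *ᵥ v
  simp only [betaSepModule, IsSeparatingSet, hinv, horb]

end SepNoether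

theorem mainTheorem3 {K : Type*} [Field K] {G : Type*} [Group G]
    (e : G ≃* Matrix.SpecialLinearGroup (Fin 2) (ZMod 3))
    (hchar : ¬ ringChar K ∣ Nat.card G)
    (hK : ∃ ξ : K, orderOf ξ = 8) :
    SepNoether.betaSep K G = 12 := by
  have hcard : Nat.card G = 24 := by
    rw [Nat.card_congr e.toEquiv, Nat.card_eq_fintype_card]
    exact SL23.card_eq
  have h24 : (24 : K) ≠ 0 := fun h => hchar (by
    rw [hcard]
    exact (ringChar.spec K 24).1 (by exact_mod_cast h))
  have h2 : (2 : K) ≠ 0 := fun h => h24 (by linear_combination 12 * h)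
  have h3 : (3 : K) ≠ 0 := fun h => h24 (by linear_combination 8 * h)
  obtain ⟨ξ, hξ⟩ := hK
  have hξ4 : ξ ^ 4 = -1 := by
    have h8 : ξ ^ 8 = 1 := hξ ▸ pow_orderOf_eq_one ξ
    have hne : ξ ^ 4 ≠ 1 := pow_ne_one_of_lt_orderOf (by norm_num) (by rw [hξ]; norm_num)
    have : (ξ ^ 4 - 1) * (ξ ^ 4 + 1) = 0 := by linear_combination h8
    exact eq_neg_of_add_eq_zero_left ((mul_eq_zero.1 this).resolve_left (sub_ne_zero.2 hne))
  have hι : ξ ^ 2 * ξ ^ 2 = -1 := by linear_combination hξ4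
  apply le_antisymm
  · refine iSup₂_le fun n ψ => ?_
    rw [← SepNoether.betaSepModule_comp e.symm ψ]
    exact SepNoether.betaSepModule_le_twelve h2 h3 _
  · refine le_trans ?_ (le_iSup₂ (f := fun n (ψ : G →* GL (Fin n) K) =>
      SepNoether.betaSepModule ψ) 2 ((SepNoether.hurwitzModule (ξ ^ 2) hι h2).comp e.toMonoidHom))
    rw [SepNoether.betaSepModule_comp]
    exact SepNoether.twelve_le_betaSepModule ξ hξ4 h24 hι h2
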